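/- Let $S$ be a scheme and let $p_1,p_2 : R \rightrightarrows X$ be an equivalence relation in the category of $S$-schemes: $R$ and $X$ are $S$-schemes, $p_1,p_2$ are $S$-morphisms, and for every $S$-scheme $T$ the map $(p_1,p_2) : R(T) \to X(T)\times X(T)$ is injective and its image is the graph of an equivalence relation on $X(T)$. A *quasi-section* of $(p_1,p_2)$ is a (locally closed) subscheme $U \hookrightarrow X$ such that (1) the restriction of $p_2$ to $p_1^{-1}(U) = R\times_{p_1,X}U$ is a finite, locally free and surjective morphism $p_1^{-1}(U) \to X$; (2) for every $x \in U$ the set $p_1(p_2^{-1}(x)) \cap U$ is contained in an affine open subset of $U$. Suppose that $(p_1,p_2)$ admits a quasi-section. Then there exist an $S$-scheme $Q$ and an $S$-morphism $\pi : X \to Q$ with the following properties. (i) $\pi$ is a cokernel (coequalizer) of $(p_1,p_2)$ in the category of $S$-schemes, and the underlying morphism of ringed spaces is a cokernel of $(p_1,p_2)$ in the category of all ringed spaces. (i') $\pi$ is surjective. If $p_1$ is open (resp. universally closed, resp. flat), then so is $\pi$. (ii) If $S$ is locally noetherian and $X$ is locally of finite type (resp. of finite type) over $S$, then $\pi : X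 \to Q$ and $Q \to S$ are locally of finite presentation (resp. of finite presentation). (iii) The morphism $(p_1,p_2) : R \to X\times_Q X$ is an isomorphism. -/

import Mathlib

open CategoryTheory CategoryTheory.Limits AlgebraicGeometry

universe u v w

/-- The pair `p₁, p₂ : R ⇉ X` is an equivalence relation on `X` in the category `C`: for every
object `T`, the map `R(T) → X(T) × X(T)` is injective and its image is the graph of an equivalence
relation on the set `X(T)`. It is applied to the category of schemes over a base `S`. -/
structure IsEquivRel {C : Type w} [Category.{v} C] {R X : C} (p₁ p₂ : R ⟶ X) : Prop where
  injective : ∀ ⦃T : C⦄ (r r' : T ⟶ R), r ≫ p₁ = r' ≫ p₁ → r ≫ p₂ = r' ≫ p₂ → r = r'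
  equivalence : ∀ T : C, Equivalence fun a b : T ⟶ X => ∃ r : T ⟶ R, r ≫ p₁ = a ∧ r ≫ p₂ = b

/-- `π : X ⟶ Q` is a cokernel (coequalizer) of `p₁, p₂ : R ⇉ X` in the category `C`. -/
def IsCoequalizerOf {C : Type w} [Category.{v} C] {R X Q : C} (p₁ p₂ : R ⟶ X) (π : X ⟶ Q) :
    Prop :=
  ∃ h : p₁ ≫ π = p₂ ≫ π, Nonempty (IsColimit (Cofork.ofπ π h))

namespace AlgebraicGeometry

/-- The functor sending a scheme to its underlying ringed space. -/
noncomputable def schemeToRingedSpace : Scheme.{u} ⥤ RingedSpace.{u} :=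
  Scheme.forgetToLocallyRingedSpace ⋙ LocallyRingedSpace.forgetToSheafedSpace

/-- `f : X ⟶ Y` is finite and locally free: it is finite, and `Y` is covered by affine opens `W`
such that `Γ(X, f⁻¹ W)` is a free module over `Γ(Y, W)` (of finite rank, as `f` is finite). -/
def IsFiniteLocallyFree {X Y : Scheme.{u}} (f : X ⟶ Y) : Prop :=
  IsFinite f ∧ ∀ y : Y, ∃ W : Y.Opens, y ∈ W ∧ IsAffineOpen W ∧
    letI := (f.app W).hom.toAlgebra
    Module.Free Γ(Y, W) Γ(X, f ⁻¹ᵁ W)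

/-- Morphisms of finite presentation: locally of finite presentation, quasi-compact and
quasi-separated. -/
def IsOfFinitePresentation {X Y : Scheme.{u}} (f : X ⟶ Y) : Prop :=
  LocallyOfFinitePresentation f ∧ QuasiCompact f ∧ QuasiSeparated f

/-- The subscheme given by the immersion `i : U ⟶ X` is a quasi-section of `p₁, p₂ : R ⇉ X`.
The scheme `p₁⁻¹(U)` is the fibre product of `p₁` and `i`, and the restriction of `p₂` to it is the
composite with the first projection. The last field says that for every `x ∈ U` the set
`p₁ (p₂⁻¹ (x)) ∩ U` is contained in an affine open of `U`. -/
structure IsQuasiSection {R X U : Scheme.{u}} (p₁ p₂ : R ⟶ X) (i : U ⟶ X) : Prop where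
  isImmersion : IsImmersion i
  isFiniteLocallyFree : IsFiniteLocallyFree (pullback.fst p₁ i ≫ p₂)
  surjective : Surjective (pullback.fst p₁ i ≫ p₂)
  exists_isAffineOpen : ∀ x : U, ∃ W : U.Opens, IsAffineOpen W ∧
    ∀ u : U, i u ∈ p₁ '' (p₂ ⁻¹' {i x}) → u ∈ W

end AlgebraicGeometry

/-!
The idea is to construct the quotient `q : U ⟶ Q` of the quasi-section first and to extend it to `X`
by descent.

The relation restricts to an equivalence relation `s, t : V ⇉ U` on the scheme
`V = p₁⁻¹(U) ∩ p₂⁻¹(U)`. Here `t` is finite locally free and every class lies in an affine open.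
Norms along `t` (`exists_norm`) turn such an affine open into an invariant one
(`IsEquivRel.exists_invariant_affine`), so that the relation is given by two ring homomorphisms
`s, t : A → B`. As `Spec B ⟶ Spec A × Spec A` is a finite monomorphism, `B` is generated by `s(A)`
as a module over `A` through `t` (`IsRingEquivRel.span_range_eq_top`). In particular the fibre of
`B` at a point of `Spec A` has a basis of the form `s(aⱼ)`. By transitivity of the relation this is
then a basis of the fibres at all points of the same class (`IsRingEquivRel.isFiberBasis_comap`),
hence a basis of `B` over an invariant affine neighbourhood. Once the `s(aⱼ)` are a basis of `B`,
transitivity also shows that the coordinates of an element `s(x)` are invariant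
(`IsRingEquivRel.repr_apply_eq`). It follows that the `aⱼ` are a basis of `A` over the ring `C` of
invariants, and that `B = A ⊗[C] A`.

The quotients `Spec C` of these charts are glued inside the coequalizer of `s` and `t` in the
category of locally ringed spaces, which exists for formal reasons and is the concrete quotient:
the topological quotient together with the invariant functions. A faithfully flat quasi-compact
morphism is the concrete quotient by its kernel pair (`isGeometricQuotient_of_flat`), and the
concrete quotient of an invariant open is open in the concrete quotient
(`IsGeometricQuotient.isOpenImmersion`). Therefore the coequalizer is a scheme `Q`, the morphism
`q : U ⟶ Q` is finite locally free and surjective, and `V = U ×_Q U` (`IsEquivRel.exists_quotient`).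

The morphism `p₂ : p₁⁻¹(U) ⟶ X` is faithfully flat and quasi-compact, hence an effective
epimorphism, and `p₁⁻¹(U) ⟶ U ⟶ Q` descends along it to `π : X ⟶ Q`. Two points of `X` with the same
image in `Q` are locally equivalent to points of `U` with the same image, which gives `R = X ×_Q X`.
Coequalizers of `s, t` are coequalizers of `p₁, p₂` by a diagram chase
(`IsCoequalizerOf.of_restrict`). The base change of `π` along `q` is `p₁⁻¹(U) ⟶ U`, which is also a
base change of `p₁`, so properties of `p₁` pass to `π`. Finally `Q` is locally of finite type over a
locally noetherian base by the Artin–Tate lemma for the finite morphism `q`, and finite presentation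
follows from noetherianity.
-/

/-! ### The norm of a finite projective algebra -/

section Norm

variable {A B : Type*} [CommRing A] [CommRing B] [Algebra A B]

/-- A finite projective module has a finite dual basis. -/
lemma exists_dual_basis_of_finite_of_projective (A M : Type*) [CommRing A] [AddCommGroup M]
    [Module A M] [Module.Finite A M] [Module.Projective A M] :
    ∃ (n : ℕ) (b : Fin n → M) (β : Fin n → M →ₗ[A] A), ∀ x, ∑ i, β i x • b i = x := by
  obtain ⟨n, f, g, -, -, hfg⟩ := Module.Finite.exists_comp_eq_id_of_projective A M
  refine ⟨n, fun i => f (Pi.single i 1), fun i => LinearMap.proj i ∘ₗ g, fun x => ?_⟩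
  conv_rhs => rw [← LinearMap.id_apply (R := A) x, ← hfg, LinearMap.comp_apply,
    pi_eq_sum_univ' (g x)]
  simp

/-- For a finite projective algebra `B` over `A` and `b : B`, the image in `Spec A` of the zero
locus of `b` is the zero locus of a single element of `A`. With a dual basis `bᵢ, βᵢ` of `B`, the
norm `det (M_b + 1 - M_1)` is such an element, where `M_c` is the matrix with entries
`βᵢ (c * bⱼ)`: extending multiplication by `b` by the identity of a complement makes it
multiplicative in `b`. -/
theorem exists_norm [Module.Finite A B] [Module.Projective A B] (b : B) :
    ∃ a : A, ∀ q : PrimeSpectrum A, a ∈ q.asIdeal ↔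
      ∃ P : PrimeSpectrum B, P.comap (algebraMap A B) = q ∧ b ∈ P.asIdeal := by
  obtain ⟨n, e, β, hβ⟩ := exists_dual_basis_of_finite_of_projective A B
  let M : B → Matrix (Fin n) (Fin n) A := fun c => Matrix.of fun i j => β i (c * e j)
  have hM (c : B) (j : Fin n) : ∑ i, algebraMap A B (M c i j) * e i = c * e j := by
    simpa [M, Algebra.smul_def] using hβ (c * e j)
  have M_mul (c d : B) : M c * M d = M (c * d) := by
    ext i j
    have : c * d * e j = ∑ k, M d k j • (c * e k) := by
      rw [mul_assoc, ← hM d j, Finset.mul_sum]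
      simp only [Algebra.smul_def]
      exact Finset.sum_congr rfl fun k _ => by ring
    simp only [Matrix.mul_apply, M, Matrix.of_apply, this, map_sum, map_smul, smul_eq_mul]
    exact Finset.sum_congr rfl fun k _ => mul_comm _ _
  let N : B → Matrix (Fin n) (Fin n) A := fun c => M c + (1 - M 1)
  have N_mul (c d : B) : N c * N d = N (c * d) := by
    simp only [N, add_mul, mul_add, mul_sub, sub_mul, M_mul, mul_one, one_mul]
    abel
  refine ⟨(N b).det, fun q => ⟨fun hb => ?_, ?_⟩⟩
  · by_contra! hP
    -- no prime above `q` contains `b`, so some `a ∉ q` lies in `q B + b B`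
    let S := Submonoid.map (algebraMap A B) q.asIdeal.primeCompl
    have hS : ¬ Disjoint ((q.asIdeal.map (algebraMap A B) ⊔ Ideal.span {b} : Ideal B) : Set B)
        (S : Set B) := by
      intro hdis
      obtain ⟨P, hP1, hP2, hP3⟩ := Ideal.exists_le_prime_disjoint _ S hdis
      refine hP ⟨P, hP1⟩ ?_ (hP2 (le_sup_right (a := q.asIdeal.map (algebraMap A B))
        (Ideal.mem_span_singleton_self b)))
      ext a
      simp only [PrimeSpectrum.comap_asIdeal, Ideal.mem_comap]
      refine ⟨fun ha => ?_, fun ha => hP2 (le_sup_left (a := q.asIdeal.map (algebraMap A B))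
        (Ideal.mem_map_of_mem _ ha))⟩
      by_contra ha'
      exact Set.disjoint_left.mp hP3 ha ⟨a, ha', rfl⟩
    rw [Set.not_disjoint_iff] at hS
    obtain ⟨_, hx, a, ha, rfl⟩ := hS
    obtain ⟨h, hh, y, hy, hsum⟩ := Submodule.mem_sup.mp hx
    obtain ⟨g, rfl⟩ := Ideal.mem_span_singleton.mp hy
    let π := Ideal.Quotient.mk q.asIdeal
    have hMh : (M h).map π = 0 := by
      ext i j
      simp only [Matrix.map_apply, Matrix.zero_apply, π]
      rw [Ideal.Quotient.eq_zero_iff_mem]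
      have hmem : h * e j ∈ q.asIdeal.map (algebraMap A B) := Ideal.mul_mem_right _ _ hh
      have hmem' : h * e j ∈ q.asIdeal • (⊤ : Submodule A B) := by
        rw [Ideal.smul_top_eq_map]; exact hmem
      have := Submodule.mem_map_of_mem (f := β i) hmem'
      rw [Submodule.map_smul''] at this
      exact (Submodule.smul_le.mpr fun r hr n _ => Ideal.mul_mem_right _ _ hr :
        q.asIdeal • (Submodule.map (β i) ⊤) ≤ q.asIdeal) this
    have hN1 : (N (algebraMap A B a)).map π = (N (b * g)).map π := by
      have h1 : M (algebraMap A B a) = M h + M (b * g) := by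
        rw [← hsum]; ext i j; simp [M, add_mul]
      simp only [N, h1]
      rw [add_assoc, Matrix.map_add _ (map_add π), hMh, zero_add]
    have hN2 : (N (algebraMap A B a)).det ∈ q.asIdeal := by
      rw [← Ideal.Quotient.eq_zero_iff_mem]
      change π _ = 0
      rw [RingHom.map_det, RingHom.mapMatrix_apply, hN1, ← RingHom.mapMatrix_apply,
        ← RingHom.map_det, ← N_mul, Matrix.det_mul, map_mul,
        Ideal.Quotient.eq_zero_iff_mem.mpr hb, zero_mul]
    -- `a + (1 - a) M_1` is `a` times the inverse of `N a = 1 + (a - 1) M_1`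
    have hN3 : N (algebraMap A B a) * (a • 1 + (1 - a) • M 1) = a • 1 := by
      have h1 : M (algebraMap A B a) = a • M 1 := by
        ext i j; simp [M, ← Algebra.smul_def]
      have h2 : M 1 * M 1 = M 1 := by rw [M_mul, one_mul]
      have key (E : Matrix (Fin n) (Fin n) A) (hE : E * E = E) :
          (a • E + (1 - E)) * (a • 1 + (1 - a) • E) = a • 1 := by
        rw [mul_add, add_mul, add_mul, sub_mul, sub_mul]
        simp only [smul_mul_assoc, mul_smul_comm, one_mul, mul_one, hE]
        module
      simp only [N, h1]
      exact key _ h2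
    have hN4 : (a : A) ^ n ∈ q.asIdeal := by
      have := congrArg Matrix.det hN3
      rw [Matrix.det_mul, Matrix.det_smul, Matrix.det_one, mul_one, Fintype.card_fin] at this
      rw [← this]
      exact Ideal.mul_mem_right _ _ hN2
    exact ha (q.isPrime.mem_of_pow_mem _ hN4)
  · rintro ⟨P, rfl, hP⟩
    -- multiplying the row `(eⱼ)` with `N b` is multiplying it with `b`, so `b` divides the norm
    let v : Fin n → B := e
    have hv : Matrix.vecMul v ((N b).map (algebraMap A B)) = b • v := by
      ext j
      have h1 := hM b j
      have h2 := hM 1 j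
      rw [one_mul] at h2
      simp only [Matrix.vecMul, dotProduct, Matrix.map_apply, N, Matrix.add_apply,
        Matrix.sub_apply, map_add, map_sub, mul_add, mul_sub, Finset.sum_add_distrib,
        Finset.sum_sub_distrib, v, Pi.smul_apply, smul_eq_mul]
      simp only [mul_comm (e _) (algebraMap A B _), h1, h2]
      simp [Matrix.one_apply, apply_ite (algebraMap A B)]
    have hdet : algebraMap A B (N b).det • v =
        b • Matrix.vecMul v (((N b).map (algebraMap A B)).adjugate) := by
      rw [← Matrix.smul_vecMul, ← hv, Matrix.vecMul_vecMul, Matrix.mul_adjugate,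
        Matrix.vecMul_smul, Matrix.vecMul_one, RingHom.map_det, RingHom.mapMatrix_apply]
    have hmem (j) : algebraMap A B (N b).det * e j ∈ P.asIdeal := by
      have := congrFun hdet j
      simp only [Pi.smul_apply, smul_eq_mul, v] at this
      rw [this]
      exact Ideal.mul_mem_right _ _ hP
    have h1 : algebraMap A B (N b).det = ∑ i, algebraMap A B (β i 1) *
        (algebraMap A B (N b).det * e i) := by
      conv_lhs => rw [← mul_one (algebraMap A B (N b).det), ← hβ 1, Finset.mul_sum]
      exact Finset.sum_congr rfl fun i _ => by rw [Algebra.smul_def]; ring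
    change algebraMap A B (N b).det ∈ P.asIdeal
    rw [h1]
    exact Ideal.sum_mem _ fun i _ => Ideal.mul_mem_left _ _ (hmem i)

end Norm

/-! ### Families that form a basis of a fibre of a module -/

section FiberBasis

open TensorProduct

/-- The family `v` in the `A`-module `M` gives a basis of the base change of `M` to the field `L`.
For `L` the residue field of a prime this says that `v` is a basis of the fibre of `M` there. -/
def IsFiberBasis (A : Type*) {M J : Type*} [CommRing A] [AddCommGroup M] [Module A M] (v : J → M)
    (L : Type*) [Field L] [Algebra A L] : Prop :=
  ∃ b : Module.Basis J L (L ⊗[A] M), ∀ j, b j = 1 ⊗ₜ v j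

variable {A M J : Type*} [CommRing A] [AddCommGroup M] [Module A M] {v : J → M}

/-- Being a basis of a fibre does not depend on extending the residue field. -/
lemma isFiberBasis_iff_of_isScalarTower [Finite J] [Module.Finite A M] (K L : Type*) [Field K]
    [Field L] [Algebra A K] [Algebra A L] [Algebra K L] [IsScalarTower A K L] :
    IsFiberBasis A v L ↔ IsFiberBasis A v K := by
  let e := AlgebraTensorModule.cancelBaseChange A K L L M
  have := Fintype.ofFinite J
  constructor
  · rintro ⟨b, hb⟩
    have hfin : Module.finrank K (K ⊗[A] M) = Fintype.card J := by
      rw [← Module.finrank_baseChange (R := L), e.finrank_eq, Module.finrank_eq_card_basis b]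
    have hli : LinearIndependent K fun j => (1 : K) ⊗ₜ[A] v j := by
      rw [Fintype.linearIndependent_iff]
      intro c hc j
      have h1 : ∑ j, algebraMap K L (c j) • b j = 0 := by
        have := congrArg (fun x => e ((1 : L) ⊗ₜ[K] x)) hc
        simpa [e, tmul_sum, smul_tmul', hb, Algebra.algebraMap_eq_smul_one, tmul_smul] using this
      have := Fintype.linearIndependent_iff.mp b.linearIndependent _ h1 j
      simpa using this
    have hsp := hli.span_eq_top_of_card_eq_finrank' hfin.symm
    exact ⟨.mk hli hsp.ge, fun j => by simp⟩
  · rintro ⟨b, hb⟩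
    exact ⟨(b.baseChange L).map e, fun j => by simp [e, hb]⟩

lemma IsFiberBasis.of_isBaseChange {A' M' : Type*} [CommRing A'] [Algebra A A'] [AddCommGroup M']
    [Module A M'] [Module A' M'] [IsScalarTower A A' M'] {f : M →ₗ[A] M'} (hf : IsBaseChange A' f)
    (L : Type*) [Field L] [Algebra A L] [Algebra A' L] [IsScalarTower A A' L]
    (h : IsFiberBasis A v L) : IsFiberBasis A' (f ∘ v) L := by
  obtain ⟨b, hb⟩ := h
  let e : L ⊗[A] M ≃ₗ[L] L ⊗[A'] M' :=
    (AlgebraTensorModule.cancelBaseChange A A' L L M).symm ≪≫ₗ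
      AlgebraTensorModule.congr (LinearEquiv.refl L L) hf.equiv
  exact ⟨b.map e, fun j => by simp [e, hb, IsBaseChange.equiv_tmul]⟩

/-- The images of generators of a module span each fibre, so they contain a basis of it. -/
lemma exists_isFiberBasis_of_span_eq_top {S : Set M} (hS : Submodule.span A S = ⊤)
    [Module.Finite A M] (L : Type*) [Field L] [Algebra A L] :
    ∃ (n : ℕ) (v : Fin n → M), (∀ j, v j ∈ S) ∧ IsFiberBasis A v L := by
  let T : Set (L ⊗[A] M) := TensorProduct.mk A L M 1 '' S
  have hT : Submodule.span L T = ⊤ := by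
    have := Submodule.baseChange_span (R := A) L S
    rw [hS, Submodule.baseChange_top] at this
    exact this.symm
  obtain ⟨f, hf, hsp, hli⟩ := Submodule.exists_fun_fin_finrank_span_eq L T
  choose v hv hvf using hf
  refine ⟨_, v, hv, .mk hli (by rw [hsp, hT]), fun j => by simpa using (hvf j).symm⟩

section

variable [Fintype J] [Module.Finite A M] [Module.Projective A M]

/-- By Nakayama's lemma, a basis of the fibre at `q` is a family of the right cardinality that
generates the module near `q`. Both conditions are open in `q`. -/
lemma isFiberBasis_residueField_iff (q : PrimeSpectrum A) :
    IsFiberBasis A v q.asIdeal.ResidueField ↔ Module.rankAtStalk M q = Fintype.card J ∧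
      q ∉ Module.support A (M ⧸ Submodule.span A (Set.range v)) := by
  let K := q.asIdeal.ResidueField
  let N := Submodule.span A (Set.range v)
  have hrank : Module.rankAtStalk M q = Module.finrank K (K ⊗[A] M) := by
    have := Module.rankAtStalk_baseChange (R := A) (M := M) (S := K) (⊥ : PrimeSpectrum K)
    rw [Module.rankAtStalk_eq_finrank_of_free] at this
    simp only [Pi.natCast_apply, Nat.cast_id] at this
    rw [this]
    congr 1
    ext x
    simp [PrimeSpectrum.comap_asIdeal, K]
  have hsupp : q ∉ Module.support A (M ⧸ N) ↔
      ⊤ ≤ Submodule.span K (Set.range fun j => (1 : K) ⊗ₜ[A] v j) := by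
    rw [Module.mem_support_iff_nontrivial_residueField_tensorProduct,
      not_nontrivial_iff_subsingleton]
    have h1 : Submodule.span K (Set.range fun j => (1 : K) ⊗ₜ[A] v j) = N.baseChange K := by
      rw [Submodule.baseChange_span, ← Set.range_comp]; rfl
    have hex : Function.Exact (N.subtype.lTensor K) (N.mkQ.lTensor K) :=
      lTensor_exact K (LinearMap.exact_subtype_mkQ N) N.mkQ_surjective
    have hsurj := LinearMap.lTensor_surjective K N.mkQ_surjective
    rw [h1, Submodule.baseChange]
    constructor
    · intro _ x _
      obtain ⟨y, hy⟩ := (hex x).mp (Subsingleton.elim _ _)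
      exact ⟨y, hy⟩
    · intro h
      refine subsingleton_of_forall_eq 0 fun x => ?_
      obtain ⟨y, rfl⟩ := hsurj x
      obtain ⟨z, hz⟩ := h (Submodule.mem_top (x := y))
      exact (hex y).mpr ⟨z, hz⟩
  rw [hsupp, hrank]
  constructor
  · rintro ⟨b, hb⟩
    refine ⟨Module.finrank_eq_card_basis b, ?_⟩
    rw [← b.span_eq]
    exact Submodule.span_mono (by rintro _ ⟨j, rfl⟩; exact ⟨j, (hb j).symm⟩)
  · rintro ⟨h1, h2⟩
    exact ⟨basisOfTopLeSpanOfCardEqFinrank _ h2 h1.symm, fun j => by simp⟩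

lemma isOpen_setOf_isFiberBasis (v : J → M) :
    IsOpen {q : PrimeSpectrum A | IsFiberBasis A v q.asIdeal.ResidueField} := by
  simp only [isFiberBasis_residueField_iff]
  have : Module.FinitePresentation A M := Module.finitePresentation_of_projective A M
  refine IsOpen.inter ?_ ?_
  · exact (Module.isLocallyConstant_rankAtStalk (R := A) (M := M)).isOpen_fiber (Fintype.card J)
  · exact Module.isClosed_support.isOpen_compl

/-- A family in a finite projective module that is a basis of all fibres is a basis. -/
lemma exists_basis_of_forall_isFiberBasis
    (h : ∀ q : PrimeSpectrum A, IsFiberBasis A v q.asIdeal.ResidueField) :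
    ∃ b : Module.Basis J A M, ∀ j, b j = v j := by
  simp only [isFiberBasis_residueField_iff] at h
  have hsub : Subsingleton (M ⧸ Submodule.span A (Set.range v)) := by
    rw [← Module.support_eq_empty_iff (R := A), Set.eq_empty_iff_forall_notMem]
    exact fun q => (h q).2
  have hspan : Submodule.span A (Set.range v) = ⊤ := by
    exact (Submodule.Quotient.subsingleton_iff).mp hsub
  have hsurj : Function.Surjective (Fintype.linearCombination A v) := by
    rw [← LinearMap.range_eq_top, Fintype.range_linearCombination, hspan]
  have hbij : Function.Bijective (Fintype.linearCombination A v) := by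
    refine Module.bijective_of_surjective_of_rankAtStalk_eq hsurj fun m _ => ?_
    have : Nontrivial A := ⟨⟨0, 1, fun h0 => Ideal.IsPrime.ne_top' (I := m)
      ((Ideal.eq_top_iff_one m).mpr (h0 ▸ m.zero_mem))⟩⟩
    rw [(h _).1, Module.rankAtStalk_eq_finrank_of_free]
    simp
  refine ⟨(Pi.basisFun A J).map (LinearEquiv.ofBijective _ hbij), fun j => ?_⟩
  classical
  simp [Fintype.linearCombination_apply_single]

end

end FiberBasis

/-! ### Affine equivalence relations -/

section Affine

open TensorProduct

/-- The pair `s, t : A → B` makes `Spec B ⇉ Spec A` an equivalence relation, expressed through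
points with values in commutative rings. -/
structure IsRingEquivRel {A B : Type u} [CommRing A] [CommRing B] (s t : A →+* B) : Prop where
  inj : ∀ (T : Type u) [CommRing T] (φ ψ : B →+* T),
    φ.comp s = ψ.comp s → φ.comp t = ψ.comp t → φ = ψ
  refl : ∃ e : B →+* A, e.comp s = RingHom.id A ∧ e.comp t = RingHom.id A
  symm : ∀ (T : Type u) [CommRing T] (φ : B →+* T),
    ∃ χ : B →+* T, χ.comp s = φ.comp t ∧ χ.comp t = φ.comp s
  trans : ∀ (T : Type u) [CommRing T] (φ ψ : B →+* T), φ.comp t = ψ.comp s →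
    ∃ χ : B →+* T, χ.comp s = φ.comp s ∧ χ.comp t = ψ.comp t

lemma exists_ringHom_tmul {A B L N : Type*} [CommRing A] [CommRing B] [CommRing L] [CommRing N]
    [Algebra A B] [Algebra A L] (α : L →+* N) (β : B →+* N)
    (h : α.comp (algebraMap A L) = β.comp (algebraMap A B)) :
    ∃ E : L ⊗[A] B →+* N, ∀ l x, E (l ⊗ₜ x) = α l * β x := by
  let := (β.comp (algebraMap A B)).toAlgebra
  let α' : L →ₐ[A] N := { α with commutes' := RingHom.congr_fun h }
  let β' : B →ₐ[A] N := { β with commutes' := fun _ => rfl }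
  exact ⟨(Algebra.TensorProduct.lift α' β' fun _ _ => Commute.all _ _ : _ →ₐ[A] _),
    fun l x => rfl⟩

namespace IsRingEquivRel

variable {A B : Type u} [CommRing A] [CommRing B] [Algebra A B] {s : A →+* B}

section Basis

variable {J : Type*} [Fintype J] (b : Module.Basis J A B) {a : J → A}

/-- Coordinates of `s x` in a basis consisting of elements `s (a j)` are invariant. Over a triple
`x ~ y ~ z` of equivalent points, the `s (a j)` restricted to the common class of `y` and `z` are a
basis, so the coordinates at `y` and those at `z` agree. -/
lemma repr_apply_eq (h : IsRingEquivRel s (algebraMap A B)) (hb : ∀ j, b j = s (a j)) (x : A)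
    (j : J) : s (b.repr (s x) j) = algebraMap A B (b.repr (s x) j) := by
  -- `N = Λ ⊗ B` classifies composable pairs of equivalences when `Λ = B`, regarded as an
  -- `A`-algebra through `s`
  have aux (Λ : Type u) [CommRing Λ] (g : A →+* Λ) : ∃ (N : Type u) (_ : CommRing N)
      (p : B →+* N) (q : Λ →+* N), p.comp (algebraMap A B) = q.comp g ∧
      ∀ c : J → Λ, ∑ j, q (c j) * p (b j) = 0 → c = 0 := by
    let := g.toAlgebra
    refine ⟨Λ ⊗[A] B, inferInstance, (Algebra.TensorProduct.includeRight : B →ₐ[A] Λ ⊗[A] B),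
      Algebra.TensorProduct.includeLeftRingHom, ?_, fun c hc => ?_⟩
    · ext r
      exact (Algebra.TensorProduct.includeRight : B →ₐ[A] Λ ⊗[A] B).commutes r
    · have h1 : ∑ j, c j • b.baseChange Λ j = 0 := by
        rw [← hc]
        exact Finset.sum_congr rfl fun j _ => by simp [smul_tmul']
      funext j
      exact Fintype.linearIndependent_iff.mp (b.baseChange Λ).linearIndependent c h1 j
  obtain ⟨N, _, p, q, hpq, hN⟩ := aux B s
  obtain ⟨χ, hχs, hχt⟩ := h.trans N p q hpq
  have hx : ∑ j, algebraMap A B (b.repr (s x) j) * s (a j) = s x := by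
    simpa [Algebra.smul_def, hb] using b.sum_repr (s x)
  have h1 : ∑ j, q (s (b.repr (s x) j)) * p (s (a j)) = p (s x) := by
    have := congrArg p hx
    simpa only [map_sum, map_mul, ← RingHom.comp_apply p (algebraMap A B), hpq,
      RingHom.comp_apply] using this
  have h2 : ∑ j, q (algebraMap A B (b.repr (s x) j)) * p (s (a j)) = p (s x) := by
    have := congrArg χ hx
    have hs' (r : A) : χ (s r) = p (s r) := RingHom.congr_fun hχs r
    have ht' (r : A) : χ (algebraMap A B r) = q (algebraMap A B r) := RingHom.congr_fun hχt r
    simpa only [map_sum, map_mul, hs', ht'] using this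
  have h3 := hN (fun j => s (b.repr (s x) j) - algebraMap A B (b.repr (s x) j)) (by
    simp only [hb, map_sub, sub_mul, Finset.sum_sub_distrib, h1, h2, sub_self])
  exact sub_eq_zero.mp (congrFun h3 j)

variable (h : IsRingEquivRel s (algebraMap A B)) (hb : ∀ j, b j = s (a j))

include h hb in
/-- If elements `s (a j)` form a basis of `B` over `A`, then the `a j` form a basis of `A` over the
ring of invariants. -/
lemma exists_basis_eqLocus :
    ∃ b' : Module.Basis J (s.eqLocus (algebraMap A B)) A, ∀ j, b' j = a j := by
  obtain ⟨e, hes, het⟩ := h.refl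
  have hes' (x : A) : e (s x) = x := RingHom.congr_fun hes x
  have het' (x : A) : e (algebraMap A B x) = x := RingHom.congr_fun het x
  let C := s.eqLocus (algebraMap A B)
  have hli : LinearIndependent C a := by
    rw [Fintype.linearIndependent_iff]
    intro c hc j
    have h1 : ∑ j, (c j : A) • b j = 0 := by
      have := congrArg s hc
      simp only [Subring.smul_def, smul_eq_mul, map_sum, map_mul, map_zero] at this
      rw [← this]
      refine Finset.sum_congr rfl fun j _ => ?_
      rw [hb, Algebra.smul_def, show s (c j) = algebraMap A B (c j) from (c j).2]
    exact Subtype.ext (Fintype.linearIndependent_iff.mp b.linearIndependent _ h1 j)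
  refine ⟨.mk hli fun x _ => ?_, fun j => by simp⟩
  have hx : ∑ j, (⟨b.repr (s x) j, h.repr_apply_eq b hb x j⟩ : C) • a j = x := by
    have := congrArg e (b.sum_repr (s x))
    simp only [Algebra.smul_def, hb, hes', het', map_sum, map_mul] at this
    exact this
  rw [← hx]
  exact Submodule.sum_mem _ fun j _ => Submodule.smul_mem _ _ (Submodule.subset_span ⟨j, rfl⟩)

include h hb in
/-- If elements `s (a j)` form a basis of `B` over `A`, then `B` is the tensor product of two copies
of `A` over the ring of invariants. -/
lemma isPushout_eqLocus :
    IsPushout (CommRingCat.ofHom (s.eqLocus (algebraMap A B)).subtype)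
      (CommRingCat.ofHom (s.eqLocus (algebraMap A B)).subtype)
      (CommRingCat.ofHom (algebraMap A B)) (CommRingCat.ofHom s) := by
  let C := s.eqLocus (algebraMap A B)
  obtain ⟨b', hb'⟩ := h.exists_basis_eqLocus b hb
  let s' : A →ₐ[C] B := { s with commutes' := fun c => c.2 }
  let f : A ⊗[C] A →ₐ[A] B := Algebra.TensorProduct.lift (Algebra.ofId A B) s'
    fun _ _ => Commute.all _ _
  have hf : Function.Bijective f := by
    have : f.toLinearMap = ((b'.baseChange A).equiv b (Equiv.refl J)).toLinearMap := by
      refine (b'.baseChange A).ext fun j => ?_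
      rw [LinearEquiv.coe_coe, Module.Basis.equiv_apply, Module.Basis.baseChange_apply, hb',
        Equiv.refl_apply, hb]
      change f (1 ⊗ₜ a j) = _
      simp only [f, Algebra.TensorProduct.lift_tmul, map_one, one_mul]
      rfl
    have h2 : (f : A ⊗[C] A → B) = (b'.baseChange A).equiv b (Equiv.refl J) :=
      congrArg DFunLike.coe this
    rw [h2]
    exact LinearEquiv.bijective _
  refine (CommRingCat.isPushout_tensorProduct C A A).of_iso (Iso.refl _) (Iso.refl _)
    (Iso.refl _) (RingEquiv.ofBijective f hf).toCommRingCatIso ?_ ?_ ?_ ?_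
  · rfl
  · rfl
  · ext x; simp [f, Algebra.ofId_apply]
  · ext x; simp [f]; rfl

end Basis

/-- For equivalent points `φ` and `ψ` of `Spec A`, a family `s (a j)` is a basis of the fibre at `ψ`
if it is one at `φ`: both are functions on the same equivalence class. The point `ψ` takes its
values in a copy `L'` of `L`, since the two points make `L` an algebra over `A` in different
ways. -/
lemma isFiberBasis_of_equiv (h : IsRingEquivRel s (algebraMap A B))
    (hgen : Submodule.span A (Set.range s) = ⊤) {J : Type*} [Finite J] {a : J → A} {L L' : Type u}
    [Field L] [Field L'] [Algebra A L] [Algebra A L'] (i : L ≃+* L') (ρ : B →+* L)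
    (hs : ρ.comp s = algebraMap A L)
    (ht : (i.toRingHom.comp ρ).comp (algebraMap A B) = algebraMap A L')
    (hb : IsFiberBasis A (fun j => s (a j)) L) : IsFiberBasis A (fun j => s (a j)) L' := by
  -- transitivity transports functions between the two fibres
  have aux {L L' : Type u} [Field L] [Field L'] [Algebra A L] [Algebra A L'] (i : L ≃+* L')
      (ρ : B →+* L) (hs : ρ.comp s = algebraMap A L)
      (ht : (i.toRingHom.comp ρ).comp (algebraMap A B) = algebraMap A L') :
      ∃ E : L' ⊗[A] B →+* L ⊗[A] B, ∀ (l : L') (x : A), E (l ⊗ₜ s x) = i.symm l ⊗ₜ s x := by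
    let φ : B →+* L ⊗[A] B := (Algebra.TensorProduct.includeRight : B →ₐ[A] L ⊗[A] B)
    let ψ : B →+* L ⊗[A] B := Algebra.TensorProduct.includeLeftRingHom.comp ρ
    have hφψ : φ.comp (algebraMap A B) = ψ.comp s := by
      ext r
      have h1 := (Algebra.TensorProduct.includeRight : B →ₐ[A] L ⊗[A] B).commutes r
      have h2 : ρ (s r) = algebraMap A L r := RingHom.congr_fun hs r
      change (Algebra.TensorProduct.includeRight : B →ₐ[A] L ⊗[A] B) (algebraMap A B r) =
        ρ (s r) ⊗ₜ 1
      rw [h1, h2]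
      rfl
    obtain ⟨χ, hχs, hχt⟩ := h.trans _ φ ψ hφψ
    let α : L' →+* L ⊗[A] B :=
      (Algebra.TensorProduct.includeLeftRingHom (R := A) (A := L) (B := B)).comp i.symm.toRingHom
    have hα : α.comp (algebraMap A L') = χ.comp (algebraMap A B) := by
      rw [hχt, ← ht]
      ext r; simp [α, ψ]
    obtain ⟨E, hE⟩ := exists_ringHom_tmul α χ hα
    refine ⟨E, fun l x => ?_⟩
    have h1 : χ (s x) = 1 ⊗ₜ s x := RingHom.congr_fun hχs x
    rw [hE, h1]
    simp [α]
  obtain ⟨E, hE⟩ := aux i ρ hs ht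
  obtain ⟨χ, hχs, hχt⟩ := h.symm L' (i.toRingHom.comp ρ)
  obtain ⟨F, hF⟩ := aux i.symm χ (hχs.trans ht) (by
    rw [RingHom.comp_assoc, hχt, ← hs]; ext x; simp)
  have hgen' : Submodule.span L' (Set.range fun x => (1 : L') ⊗ₜ[A] s x) = ⊤ := by
    have := Submodule.baseChange_span (R := A) L' (Set.range s)
    rw [hgen, Submodule.baseChange_top, ← Set.range_comp] at this
    exact this.symm
  obtain ⟨b, hb⟩ := hb
  have := Fintype.ofFinite J
  refine ⟨.mk (v := fun j => 1 ⊗ₜ s (a j)) ?_ ?_, Module.Basis.mk_apply _ _⟩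
  · rw [Fintype.linearIndependent_iff]
    intro c hc j
    have h1 : ∑ j, i.symm (c j) • b j = 0 := by
      have := congrArg E hc
      simpa [hb, smul_tmul', hE] using this
    simpa using Fintype.linearIndependent_iff.mp b.linearIndependent _ h1 j
  · rw [← hgen', Submodule.span_le]
    rintro _ ⟨x, rfl⟩
    have h1 := congrArg F (b.sum_repr (1 ⊗ₜ s x))
    simp only [hb, smul_tmul', smul_eq_mul, mul_one, map_sum, hF] at h1
    have h2 : ∑ j, i (b.repr (1 ⊗ₜ s x) j) • (1 : L') ⊗ₜ[A] s (a j) = 1 ⊗ₜ s x := by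
      simpa [smul_tmul'] using h1
    rw [SetLike.mem_coe]
    beta_reduce
    rw [← h2]
    exact Submodule.sum_mem _ fun j _ => Submodule.smul_mem _ _ (Submodule.subset_span ⟨j, rfl⟩)

/-- `Spec B → Spec A × Spec A` is a finite monomorphism, hence a closed immersion. -/
lemma span_range_eq_top [Module.Finite A B] (h : IsRingEquivRel s (algebraMap A B)) :
    Submodule.span A (Set.range s) = ⊤ := by
  obtain ⟨E, hE⟩ := exists_ringHom_tmul (A := ℤ) (algebraMap A B) s (RingHom.ext_int _ _)
  let E' : CommRingCat.of (A ⊗[ℤ] A) ⟶ CommRingCat.of B := CommRingCat.ofHom E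
  have hE₁ : E.comp (Algebra.TensorProduct.includeLeftRingHom) = algebraMap A B := by
    ext a; simp [hE]
  have hE₂ : E.comp (Algebra.TensorProduct.includeRight : A →ₐ[ℤ] A ⊗[ℤ] A).toRingHom = s := by
    ext a; simp [hE]
  have hsurj : Function.Surjective E' := by
    rw [RingHom.surjective_iff_epi_and_finite]
    refine ⟨⟨fun {T} φ ψ hφ => ?_⟩, ?_⟩
    · have h1 : φ.hom.comp E = ψ.hom.comp E := congrArg CommRingCat.Hom.hom hφ
      ext1
      refine h.inj T φ.hom ψ.hom ?_ ?_
      · rw [← hE₂, ← RingHom.comp_assoc, ← RingHom.comp_assoc, h1]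
      · rw [← hE₁, ← RingHom.comp_assoc, ← RingHom.comp_assoc, h1]
    · have : (algebraMap A B).Finite := RingHom.finite_algebraMap.mpr ‹_›
      rw [← hE₁] at this
      exact .of_comp_finite this
  rw [eq_top_iff]
  rintro x -
  obtain ⟨z, rfl⟩ : ∃ z, E z = x := hsurj x
  induction z with
  | zero => simp
  | tmul a a' =>
    rw [hE, ← Algebra.smul_def]
    exact Submodule.smul_mem _ _ (Submodule.subset_span ⟨a', rfl⟩)
  | add z z' hz hz' => rw [map_add]; exact add_mem hz hz'

/-- Whether functions `s (a j)` form a basis of the fibre over a point only depends on the class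
of the point. -/
lemma isFiberBasis_comap [Module.Finite A B] (h : IsRingEquivRel s (algebraMap A B))
    {J : Type*} [Finite J] {a : J → A} (P : PrimeSpectrum B)
    (hb : IsFiberBasis A (fun j => s (a j)) (P.comap s).asIdeal.ResidueField) :
    IsFiberBasis A (fun j => s (a j)) (P.comap (algebraMap A B)).asIdeal.ResidueField := by
  let K := P.asIdeal.ResidueField
  -- `L` is a copy of `K` with the other structure of `A`-algebra
  obtain ⟨L, _, ⟨i⟩⟩ : ∃ (L : Type u) (_ : Field L), Nonempty (L ≃+* K) :=
    ⟨K, inferInstance, ⟨RingEquiv.refl K⟩⟩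
  let ρ : B →+* L := i.symm.toRingHom.comp (algebraMap B K)
  let := (ρ.comp s).toAlgebra
  let g : (P.comap s).asIdeal.ResidueField →+* L :=
    i.symm.toRingHom.comp (Ideal.ResidueField.map (P.comap s).asIdeal P.asIdeal s rfl)
  let := g.toAlgebra
  have : IsScalarTower A (P.comap s).asIdeal.ResidueField L := .of_algebraMap_eq fun x => by
    change i.symm (algebraMap B K (s x)) = i.symm (Ideal.ResidueField.map _ _ s rfl
      (algebraMap A _ x))
    rw [Ideal.ResidueField.map_algebraMap]
  have h1 := (isFiberBasis_iff_of_isScalarTower (P.comap s).asIdeal.ResidueField L).mpr hb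
  have h2 : IsFiberBasis A (fun j => s (a j)) K := by
    refine h.isFiberBasis_of_equiv h.span_range_eq_top i ρ rfl ?_ h1
    ext x
    change i (i.symm (algebraMap B K (algebraMap A B x))) = algebraMap A K x
    rw [RingEquiv.apply_symm_apply, ← IsScalarTower.algebraMap_apply]
  let g' : (P.comap (algebraMap A B)).asIdeal.ResidueField →+* K :=
    Ideal.ResidueField.map (P.comap (algebraMap A B)).asIdeal P.asIdeal (algebraMap A B) rfl
  let := g'.toAlgebra
  have : IsScalarTower A (P.comap (algebraMap A B)).asIdeal.ResidueField K :=
    .of_algebraMap_eq fun x => by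
      change _ = Ideal.ResidueField.map _ _ (algebraMap A B) rfl (algebraMap A _ x)
      rw [IsScalarTower.algebraMap_apply A B K]
      exact (Ideal.ResidueField.map_algebraMap _ _ _ rfl x).symm
  exact (isFiberBasis_iff_of_isScalarTower _ K).mp h2

end IsRingEquivRel

/-- A family in `B` that is a basis of the fibres over the image of `Spec A'` becomes a basis of
`B' = A' ⊗[A] B` over `A'`. -/
lemma exists_basis_of_isPushout {A A' B B' : Type u} [CommRing A] [CommRing A'] [CommRing B]
    [CommRing B'] [Algebra A A'] [Algebra A B] [Algebra A B'] [Algebra A' B'] [Algebra B B']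
    [IsScalarTower A A' B'] [IsScalarTower A B B'] [Algebra.IsPushout A A' B B']
    [Module.Finite A B] [Module.Finite A' B'] [Module.Projective A' B']
    {J : Type*} [Fintype J] (v : J → B) (h : ∀ q : PrimeSpectrum A',
      IsFiberBasis A v (q.comap (algebraMap A A')).asIdeal.ResidueField) :
    ∃ b : Module.Basis J A' B', ∀ j, b j = algebraMap B B' (v j) := by
  refine exists_basis_of_forall_isFiberBasis (v := fun j => algebraMap B B' (v j)) fun q => ?_
  let p := q.comap (algebraMap A A')
  let K := q.asIdeal.ResidueField
  let g : p.asIdeal.ResidueField →+* K :=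
    Ideal.ResidueField.map p.asIdeal q.asIdeal (algebraMap A A') rfl
  let := g.toAlgebra
  have : IsScalarTower A p.asIdeal.ResidueField K := .of_algebraMap_eq fun x => by
    change _ = Ideal.ResidueField.map _ _ (algebraMap A A') rfl (algebraMap A _ x)
    rw [IsScalarTower.algebraMap_apply A A' K]
    exact (Ideal.ResidueField.map_algebraMap _ _ _ rfl x).symm
  have hK : IsFiberBasis A v K :=
    (isFiberBasis_iff_of_isScalarTower p.asIdeal.ResidueField K).mpr (h q)
  have hB : IsBaseChange A' (IsScalarTower.toAlgHom A B B').toLinearMap := Algebra.IsPushout.out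
  exact hK.of_isBaseChange hB K

end Affine

/-! ### Coequalizers of ringed spaces -/

namespace AlgebraicGeometry

open TopologicalSpace Opposite

namespace PresheafedSpace

variable {X Y Z : PresheafedSpace.{u, u + 1, u} CommRingCat.{u}}

/-- The map on sections induced by a morphism `f`, from an open `V` of the target to an open `O`
contained in the preimage of `V`. -/
noncomputable def secLE (f : X ⟶ Y) (V : Opens Y) (O : Opens X)
    (h : O ≤ (Opens.map f.base).obj V) : Y.presheaf.obj (op V) ⟶ X.presheaf.obj (op O) :=
  f.c.app (op V) ≫ X.presheaf.map (homOfLE h).op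

lemma secLE_self (f : X ⟶ Y) (V : Opens Y) :
    secLE f V ((Opens.map f.base).obj V) le_rfl = f.c.app (op V) := by
  simp [secLE]

lemma secLE_congr {f g : X ⟶ Y} (hfg : f = g) (V : Opens Y) (O : Opens X)
    (h : O ≤ (Opens.map f.base).obj V) : secLE f V O h = secLE g V O (hfg ▸ h) := by
  subst hfg; rfl

lemma map_secLE (f : X ⟶ Y) (V V' : Opens Y) (O : Opens X)
    (h : O ≤ (Opens.map f.base).obj V') (h' : V' ≤ V) :
    Y.presheaf.map (homOfLE h').op ≫ secLE f V' O h =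
      secLE f V O (h.trans ((Opens.map f.base).map (homOfLE h')).le) := by
  simp only [secLE, NatTrans.naturality_assoc]
  congr 1
  exact (X.presheaf.map_comp ((Opens.map f.base).map (homOfLE h')).op (homOfLE h).op).symm

lemma secLE_comp (f : X ⟶ Y) (g : Y ⟶ Z) (W : Opens Z) (V : Opens Y) (O : Opens X)
    (h : V ≤ (Opens.map g.base).obj W) (h' : O ≤ (Opens.map f.base).obj V) :
    secLE g W V h ≫ secLE f V O h' =
      secLE (f ≫ g) W O (h'.trans ((Opens.map f.base).map (homOfLE h)).le) := by
  change (g.c.app (op W) ≫ Y.presheaf.map (homOfLE h).op) ≫ secLE f V O h' = _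
  rw [Category.assoc, map_secLE]
  exact (Category.assoc _ _ _).symm

lemma secLE_comp_apply (f : X ⟶ Y) (g : Y ⟶ Z) (W : Opens Z) (V : Opens Y) (O : Opens X)
    (h : V ≤ (Opens.map g.base).obj W) (h' : O ≤ (Opens.map f.base).obj V)
    (a : Z.presheaf.obj (op W)) :
    secLE f V O h' (secLE g W V h a) =
      secLE (f ≫ g) W O (h'.trans ((Opens.map f.base).map (homOfLE h)).le) a := by
  rw [← secLE_comp f g W V O h h', CommRingCat.comp_apply]

lemma bijective_secLE_of_isOpenImmersion (j : X ⟶ Y) [IsOpenImmersion j] (V : Opens Y)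
    (hV : (V : Set Y) ⊆ Set.range j.base) (O : Opens X) (h : O ≤ (Opens.map j.base).obj V)
    (h' : (Opens.map j.base).obj V ≤ O) : Function.Bijective (secLE j V O h) := by
  obtain rfl := le_antisymm h h'
  rw [secLE_self]
  have : IsIso (j.c.app (op V)) := by
    refine IsOpenImmersion.c_iso' j ((Opens.map j.base).obj V) ?_
    ext x
    constructor
    · intro hx
      obtain ⟨y, rfl⟩ := hV hx
      exact ⟨y, hx, rfl⟩
    · rintro ⟨y, hy, rfl⟩
      exact hy
  exact ConcreteCategory.bijective_of_isIso _

end PresheafedSpace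

open PresheafedSpace

variable {R X Q : PresheafedSpace.{u, u + 1, u} CommRingCat.{u}}

/-- The morphism `π : X ⟶ Q` exhibits `Q` as the quotient of `X` by `f, g : R ⇉ X` in the concrete
sense: its space is the topological quotient by the equivalence relation that `R` generates, and
sections over an open `V` of `Q` are the invariant sections over the preimage of `V`. -/
structure IsGeometricQuotient (f g : R ⟶ X) (π : X ⟶ Q) : Prop where
  condition : f ≫ π = g ≫ π
  isQuotientMap : Topology.IsQuotientMap π.base
  eqvGen : ∀ x y : X, π.base x = π.base y →
    Relation.EqvGen (fun x y : X => ∃ r : R, f.base r = x ∧ g.base r = y) x y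
  injective : ∀ V : Opens Q, Function.Injective (secLE π V _ le_rfl)
  exists_section : ∀ (V : Opens Q) (a : X.presheaf.obj (op ((Opens.map π.base).obj V))),
    (∀ (O : Opens R) (h₁ : O ≤ (Opens.map f.base).obj ((Opens.map π.base).obj V))
      (h₂ : O ≤ (Opens.map g.base).obj ((Opens.map π.base).obj V)),
      secLE f _ O h₁ a = secLE g _ O h₂ a) → ∃ s, secLE π V _ le_rfl s = a

/-- Points identified by a coequalizer of topological spaces are already identified by the explicit
quotient. -/
lemma eqvGen_of_isColimit_cofork {R X : TopCat.{u}} {f g : R ⟶ X} (c : Cofork f g)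
    (hc : IsColimit c) (x y : X) (hxy : c.π x = c.π y) :
    Relation.EqvGen (fun x y : X => ∃ r : R, f r = x ∧ g r = y) x y := by
  let r : X → X → Prop := fun x y => ∃ r : R, f r = x ∧ g r = y
  let q : X ⟶ TopCat.of (Quot r) := TopCat.ofHom ⟨Quot.mk r, continuous_quot_mk⟩
  have hq : f ≫ q = g ≫ q := by
    ext z
    exact Quot.sound ⟨z, rfl, rfl⟩
  obtain ⟨l, hl⟩ := Cofork.IsColimit.desc' hc q hq
  have : q x = q y := by
    rw [← hl]
    exact congrArg l hxy
  exact Quot.eqvGen_exact this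

namespace IsGeometricQuotient

lemma of_iso {f g : R ⟶ X} {π : X ⟶ Q} (h : IsGeometricQuotient f g π)
    {Q' : PresheafedSpace.{u, u + 1, u} CommRingCat.{u}} (e : Q ≅ Q') :
    IsGeometricQuotient f g (π ≫ e.hom) where
  condition := by rw [← Category.assoc, h.condition, Category.assoc]
  isQuotientMap :=
    (TopCat.homeoOfIso (asIso e.hom.base)).isQuotientMap.comp h.isQuotientMap
  eqvGen x y hxy := h.eqvGen x y ((TopCat.homeoOfIso (asIso e.hom.base)).injective hxy)
  injective V a b hab := by
    change secLE (π ≫ e.hom) V ((Opens.map π.base).obj ((Opens.map e.hom.base).obj V)) _ a =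
      secLE (π ≫ e.hom) V ((Opens.map π.base).obj ((Opens.map e.hom.base).obj V)) _ b at hab
    rw [← secLE_comp_apply _ _ _ ((Opens.map e.hom.base).obj V) _ le_rfl le_rfl,
      ← secLE_comp_apply _ _ _ ((Opens.map e.hom.base).obj V) _ le_rfl le_rfl] at hab
    exact (bijective_secLE_of_isOpenImmersion e.hom V (fun x _ =>
      (TopCat.homeoOfIso (asIso e.hom.base)).surjective x) _ le_rfl le_rfl).1 (h.injective _ hab)
  exists_section V a ha := by
    obtain ⟨s, hs⟩ := h.exists_section ((Opens.map e.hom.base).obj V) a ha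
    obtain ⟨s', rfl⟩ := (bijective_secLE_of_isOpenImmersion e.hom V (fun x _ =>
      (TopCat.homeoOfIso (asIso e.hom.base)).surjective x) _ le_rfl le_rfl).2 s
    exact ⟨s', by rw [← hs, secLE_comp_apply]; rfl⟩

open WalkingParallelPair WalkingParallelPairHom in
/-- Colimits of presheafed spaces are computed on the underlying spaces, and their sections are
limits of sections. -/
lemma of_colimit (f g : R ⟶ X) :
    IsGeometricQuotient f g (colimit.ι (parallelPair f g) one) := by
  let F := parallelPair f g
  let π : X ⟶ Limits.colimit F := colimit.ι F one
  have hf : f ≫ π = colimit.ι F zero := colimit.w F left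
  have hg : g ≫ π = colimit.ι F zero := colimit.w F right
  have hc : IsColimit (Cofork.ofπ π (hf.trans hg.symm)) := coequalizerIsCoequalizer f g
  have hc' := isColimitCoforkMapOfIsColimit (PresheafedSpace.forget _) _ hc
  refine ⟨hf.trans hg.symm, ?_, ?_, ?_, ?_⟩
  · exact TopCat.isQuotientMap_of_isColimit_cofork _ hc'
  · exact eqvGen_of_isColimit_cofork _ hc'
  · intro V a b hab
    rw [secLE_self] at hab
    let D := componentwiseDiagram F V
    let I := colimitPresheafObjIsoComponentwiseLimit F V
    have h1 (x : (Limits.colimit F).presheaf.obj (op V)) :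
        limit.π D (op one) (I.hom x) = π.c.app (op V) x :=
      ConcreteCategory.congr_hom (colimitPresheafObjIsoComponentwiseLimit_hom_π F V one) x
    have h2 : limit.π D (op one) (I.hom a) = limit.π D (op one) (I.hom b) := by
      rw [h1, h1]; exact hab
    refine (ConcreteCategory.bijective_of_isIso I.hom).1 (Concrete.limit_ext D _ _ ?_)
    rintro ⟨_ | _⟩
    · rw [← ConcreteCategory.congr_hom (limit.w D (op left)) (I.hom a),
        ← ConcreteCategory.congr_hom (limit.w D (op left)) (I.hom b)]
      exact congrArg (D.map (op left)) h2
    · exact h2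
  · intro V a ha
    let D := componentwiseDiagram F V
    let I := colimitPresheafObjIsoComponentwiseLimit F V
    have h1 (x : (Limits.colimit F).presheaf.obj (op V)) :
        limit.π D (op one) (I.hom x) = π.c.app (op V) x :=
      ConcreteCategory.congr_hom (colimitPresheafObjIsoComponentwiseLimit_hom_π F V one) x
    have hO : (Opens.map (colimit.ι F zero).base).obj V ≤
        (Opens.map f.base).obj ((Opens.map π.base).obj V) := by rw [← hf]; rfl
    have hO' : (Opens.map (colimit.ι F zero).base).obj V ≤
        (Opens.map g.base).obj ((Opens.map π.base).obj V) := by rw [← hg]; rfl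
    have hD : D.map (op left) a = D.map (op right) a := ha _ hO hO'
    let E := (D.map (op left)).hom.eqLocus (D.map (op right)).hom
    let i : CommRingCat.of E ⟶ D.obj (op one) := CommRingCat.ofHom E.subtype
    have hi : i ≫ D.map (op left) = i ≫ D.map (op right) := by
      ext x; exact x.2
    let c : Cone D :=
      { pt := CommRingCat.of E
        π :=
          { app := fun k => match k with
              | ⟨zero⟩ => i ≫ D.map (op left)
              | ⟨one⟩ => i
            naturality := by
              rintro ⟨_⟩ ⟨_⟩ ⟨_ | _ | _⟩
              · exact Category.id_comp _
              · exact (Category.id_comp _).trans hi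
              · exact (Category.id_comp _).trans
                  ((Category.comp_id _).symm.trans (congrArg _ (D.map_id _).symm)) } }
    obtain ⟨s, hs⟩ := (ConcreteCategory.bijective_of_isIso I.hom).2 (limit.lift D c ⟨a, hD⟩)
    refine ⟨s, ?_⟩
    rw [secLE_self]
    refine (h1 s).symm.trans ?_
    rw [hs]
    exact ConcreteCategory.congr_hom (limit.lift_π c (op one)) (⟨a, hD⟩ : E)

end IsGeometricQuotient
end AlgebraicGeometry

namespace AlgebraicGeometry

open TopologicalSpace Opposite PresheafedSpace

namespace IsGeometricQuotient

section

variable {R X Q R' X' Q' : PresheafedSpace.{u, u + 1, u} CommRingCat.{u}} {f g : R ⟶ X} {π : X ⟶ Q}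
  {f' g' : R' ⟶ X'} {π' : X' ⟶ Q'} {j : X' ⟶ X} {k : R' ⟶ R} {h : Q' ⟶ Q}

/-- The quotient of an invariant open subspace is an open subspace of the quotient. -/
theorem isOpenImmersion (H : IsGeometricQuotient f g π) (H' : IsGeometricQuotient f' g' π')
    [PresheafedSpace.IsOpenImmersion j] [PresheafedSpace.IsOpenImmersion k]
    (hf : k ≫ f = f' ≫ j) (hg : k ≫ g = g' ≫ j)
    (hkf : f.base ⁻¹' Set.range j.base ⊆ Set.range k.base)
    (hkg : g.base ⁻¹' Set.range j.base ⊆ Set.range k.base) (w : π' ≫ h = j ≫ π) :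
    PresheafedSpace.IsOpenImmersion h := by
  have hjinj : Function.Injective j.base :=
    (PresheafedSpace.IsOpenImmersion.base_open (f := j)).injective
  have hf' (r : R') : f.base (k.base r) = j.base (f'.base r) :=
    ConcreteCategory.congr_hom (congrArg PresheafedSpace.Hom.base hf) r
  have hg' (r : R') : g.base (k.base r) = j.base (g'.base r) :=
    ConcreteCategory.congr_hom (congrArg PresheafedSpace.Hom.base hg) r
  have hw (x : X') : h.base (π'.base x) = π.base (j.base x) :=
    ConcreteCategory.congr_hom (congrArg PresheafedSpace.Hom.base w) x
  have hc' (r : R') : π'.base (f'.base r) = π'.base (g'.base r) :=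
    ConcreteCategory.congr_hom (congrArg PresheafedSpace.Hom.base H'.condition) r
  -- equivalence classes do not leave the image of `j`
  have key (x y : X)
      (hxy : Relation.EqvGen (fun x y : X => ∃ r : R, f.base r = x ∧ g.base r = y) x y) :
      (∀ x', j.base x' = x → ∃ y', j.base y' = y ∧ π'.base x' = π'.base y') ∧
      (∀ y', j.base y' = y → ∃ x', j.base x' = x ∧ π'.base y' = π'.base x') := by
    induction hxy with
    | rel x y hr =>
      obtain ⟨r, rfl, rfl⟩ := hr
      constructor
      · intro x' hx'
        obtain ⟨r, rfl⟩ := hkf ⟨x', hx'⟩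
        rw [hf'] at hx'
        exact ⟨g'.base r, (hg' r).symm, by rw [hjinj hx', hc']⟩
      · intro y' hy'
        obtain ⟨r, rfl⟩ := hkg ⟨y', hy'⟩
        rw [hg'] at hy'
        exact ⟨f'.base r, (hf' r).symm, by rw [hjinj hy', hc']⟩
    | refl x => exact ⟨fun x' hx' => ⟨x', hx', rfl⟩, fun x' hx' => ⟨x', hx', rfl⟩⟩
    | symm x y _ ih => exact ⟨ih.2, ih.1⟩
    | trans x y z _ _ ih₁ ih₂ =>
      constructor
      · intro x' hx'
        obtain ⟨y', hy', e₁⟩ := ih₁.1 x' hx'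
        obtain ⟨z', hz', e₂⟩ := ih₂.1 y' hy'
        exact ⟨z', hz', e₁.trans e₂⟩
      · intro z' hz'
        obtain ⟨y', hy', e₁⟩ := ih₂.2 z' hz'
        obtain ⟨x', hx', e₂⟩ := ih₁.2 y' hy'
        exact ⟨x', hx', e₁.trans e₂⟩
  have hinj : Function.Injective h.base := by
    intro a b hab
    obtain ⟨x, rfl⟩ := H'.isQuotientMap.surjective a
    obtain ⟨y, rfl⟩ := H'.isQuotientMap.surjective b
    rw [hw, hw] at hab
    obtain ⟨y', hy', e⟩ := (key _ _ (H.eqvGen _ _ hab)).1 x rfl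
    rw [e, hjinj hy']
  have himg (V : Set Q') : π.base ⁻¹' (h.base '' V) = j.base '' (π'.base ⁻¹' V) := by
    ext x
    constructor
    · rintro ⟨a, ha, e⟩
      obtain ⟨x', rfl⟩ := H'.isQuotientMap.surjective a
      rw [hw] at e
      obtain ⟨y', hy', e'⟩ := (key _ _ (H.eqvGen _ _ e)).1 x' rfl
      exact ⟨y', by rw [Set.mem_preimage, ← e']; exact ha, hy'⟩
    · rintro ⟨x', hx', rfl⟩
      exact ⟨π'.base x', hx', hw x'⟩
  have hopen : Topology.IsOpenEmbedding h.base :=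
    .of_continuous_injective_isOpenMap h.base.hom.continuous hinj fun V hV => by
      rw [← H.isQuotientMap.isOpen_preimage]
      erw [himg]
      exact (PresheafedSpace.IsOpenImmersion.base_open (f := j)).isOpenMap _
        (hV.preimage π'.base.hom.continuous)
  refine ⟨hopen, fun V' => ?_⟩
  let V : Opens Q := hopen.functor.obj V'
  have hVj : ((Opens.map π.base).obj V : Set X) ⊆ Set.range j.base := by
    change π.base ⁻¹' (h.base '' V') ⊆ _
    rw [himg]
    exact Set.image_subset_range _ _
  have hVk : ((Opens.map f.base).obj ((Opens.map π.base).obj V) : Set R) ⊆ Set.range k.base :=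
    fun r hr => hkf (hVj hr)
  have e1 : (Opens.map π'.base).obj ((Opens.map h.base).obj V) ≤
      (Opens.map j.base).obj ((Opens.map π.base).obj V) := fun x hx => by
    change π.base (j.base x) ∈ V
    rw [← hw]; exact hx
  have e2 : (Opens.map j.base).obj ((Opens.map π.base).obj V) ≤
      (Opens.map π'.base).obj ((Opens.map h.base).obj V) := fun x hx => by
    change h.base (π'.base x) ∈ V
    rw [hw]; exact hx
  have hj := bijective_secLE_of_isOpenImmersion j ((Opens.map π.base).obj V) hVj _ e1 e2
  have hcomm (s : Q.presheaf.obj (op V)) :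
      secLE π' ((Opens.map h.base).obj V) _ le_rfl (secLE h V _ le_rfl s) =
        secLE j ((Opens.map π.base).obj V) ((Opens.map π'.base).obj ((Opens.map h.base).obj V)) e1
          (secLE π V _ le_rfl s) := by
    rw [secLE_comp_apply, secLE_comp_apply]
    exact ConcreteCategory.congr_hom (secLE_congr w _ _ _) s
  have hbij : Function.Bijective (h.c.app (op V)) := by
    rw [← secLE_self]
    constructor
    · intro s s' hs
      apply H.injective V
      apply hj.1
      rw [← hcomm, ← hcomm, hs]
    · intro t
      obtain ⟨a, ha⟩ := hj.2 (secLE π' ((Opens.map h.base).obj V) _ le_rfl t)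
      obtain ⟨s, rfl⟩ := H.exists_section V a (by
        intro O h₁ h₂
        have hO : (O : Set R) ⊆ Set.range k.base := fun r hr => hVk (h₁ hr)
        -- sections over `O` are determined by their restriction to `R'`
        apply (bijective_secLE_of_isOpenImmersion k O hO _ le_rfl le_rfl).1
        rw [secLE_comp_apply, secLE_comp_apply]
        have e4 : (Opens.map k.base).obj O ≤ (Opens.map f'.base).obj
            ((Opens.map π'.base).obj ((Opens.map h.base).obj V)) := fun r hr => e2 (by
          change j.base (f'.base r) ∈ (Opens.map π.base).obj V
          rw [← hf']; exact h₁ hr)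
        have e5 : (Opens.map k.base).obj O ≤ (Opens.map g'.base).obj
            ((Opens.map π'.base).obj ((Opens.map h.base).obj V)) := fun r hr => e2 (by
          change j.base (g'.base r) ∈ (Opens.map π.base).obj V
          rw [← hg']; exact h₂ hr)
        have h3 := secLE_comp_apply f' j _ _ ((Opens.map k.base).obj O) e1 e4 a
        have h4 := secLE_comp_apply g' j _ _ ((Opens.map k.base).obj O) e1 e5 a
        rw [ha, secLE_comp_apply] at h3 h4
        refine (ConcreteCategory.congr_hom (secLE_congr hf _ _ _) a).trans (h3.symm.trans ?_)
        refine Eq.trans ?_ (h4.trans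
          (ConcreteCategory.congr_hom (secLE_congr hg _ _ _) a).symm)
        exact ConcreteCategory.congr_hom (secLE_congr H'.condition _ _ _) t)
      refine ⟨s, H'.injective _ ?_⟩
      rw [hcomm, ha]
  exact (ConcreteCategory.isIso_iff_bijective (h.c.app (op V))).mpr hbij

lemma of_isColimit (c : Cofork f g) (hc : IsColimit c) : IsGeometricQuotient f g c.π := by
  let e := (colimit.isColimit (parallelPair f g)).coconePointUniqueUpToIso hc
  have : colimit.ι (parallelPair f g) WalkingParallelPair.one ≫ e.hom = c.π :=
    (colimit.isColimit (parallelPair f g)).comp_coconePointUniqueUpToIso_hom hc _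
  rw [← this]
  exact (of_colimit f g).of_iso e

end

section

variable {R X Q : LocallyRingedSpace.{u}} {f g : R ⟶ X} {π : X ⟶ Q}

/-- The coequalizer of locally ringed spaces is computed in presheafed spaces, so it is a concrete
quotient. -/
lemma coequalizerCofork (f g : R ⟶ X) :
    IsGeometricQuotient f.toShHom.hom g.toShHom.hom
      (LocallyRingedSpace.coequalizerCofork f g).π.toShHom.hom :=
  of_isColimit _ (isColimitCoforkMapOfIsColimit SheafedSpace.forgetToPresheafedSpace _
    (coequalizerIsCoequalizer f.toShHom g.toShHom))

/-- A concrete quotient of locally ringed spaces is a coequalizer: the morphism to it from the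
coequalizer is a surjective open immersion, since both are concrete quotients. -/
theorem isCoequalizerOf (H : IsGeometricQuotient f.toShHom.hom g.toShHom.hom π.toShHom.hom) :
    IsCoequalizerOf f g π := by
  have w : f ≫ π = g ≫ π := LocallyRingedSpace.Hom.ext' H.condition
  refine ⟨w, ⟨?_⟩⟩
  let c := LocallyRingedSpace.coequalizerCofork f g
  let hc : IsColimit c := LocallyRingedSpace.coequalizerCoforkIsColimit f g
  let d : c.pt ⟶ Q := Cofork.IsColimit.desc hc π w
  have hd : c.π ≫ d = π := Cofork.IsColimit.π_desc' hc π w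
  have : PresheafedSpace.IsOpenImmersion d.toShHom.hom := by
    refine isOpenImmersion (j := 𝟙 _) (k := 𝟙 _) H (coequalizerCofork f g) ?_ ?_ ?_ ?_ ?_
    · simp
    · simp
    · exact fun r _ => ⟨r, rfl⟩
    · exact fun r _ => ⟨r, rfl⟩
    · rw [Category.id_comp, ← hd]; rfl
  have hsurj : Function.Surjective d.toShHom.hom.base := by
    have h1 : Function.Surjective (c.π ≫ d).toShHom.hom.base := by
      rw [hd]; exact H.isQuotientMap.surjective
    exact Function.Surjective.of_comp h1
  have : Epi d.toShHom.hom.base := (TopCat.epi_iff_surjective _).mpr hsurj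
  have : SheafedSpace.IsOpenImmersion d.toShHom := ‹_›
  have : IsIso d.toShHom := SheafedSpace.IsOpenImmersion.to_iso d.toShHom
  have : IsIso (LocallyRingedSpace.forgetToSheafedSpace.map d) := this
  have : IsIso d := isIso_of_reflects_iso d LocallyRingedSpace.forgetToSheafedSpace
  exact hc.ofIsoColimit (Cofork.ext (asIso d) hd)

end

end IsGeometricQuotient

lemma IsCoequalizerOf.map {C : Type*} {D : Type*} [Category C] [Category D] (F : C ⥤ D)
    [PreservesColimitsOfShape WalkingParallelPair F] {R X Q : C} {f g : R ⟶ X} {π : X ⟶ Q}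
    (h : IsCoequalizerOf f g π) : IsCoequalizerOf (F.map f) (F.map g) (F.map π) := by
  obtain ⟨w, ⟨hc⟩⟩ := h
  exact ⟨by rw [← F.map_comp, w, F.map_comp], ⟨isColimitCoforkMapOfIsColimit F w hc⟩⟩

end AlgebraicGeometry

/-! ### Flat quotients are geometric quotients -/

namespace AlgebraicGeometry

open TopologicalSpace Opposite

/-- Global functions are morphisms to the affine line, so an epimorphism is injective on them. -/
lemma Scheme.Hom.injective_appTop_of_epi {Y Z : Scheme.{u}} (q : Y ⟶ Z) [Epi q] :
    Function.Injective q.appTop := by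
  intro a b hab
  let E := fun X : Scheme.{u} => AffineSpace.toSpecMvPolyIntEquiv PUnit (X := X)
  have : (E Z).symm (fun _ => a) = (E Z).symm (fun _ => b) := by
    rw [← cancel_epi q]
    refine (E Y).injective (funext fun i => ?_)
    rw [AffineSpace.toSpecMvPolyIntEquiv_comp, AffineSpace.toSpecMvPolyIntEquiv_comp]
    simpa [E] using hab
  exact congrFun ((E Z).symm.injective this) PUnit.unit

/-- Global functions descend along effective epimorphisms, being morphisms to the affine line. -/
lemma Scheme.Hom.exists_appTop_eq_of_effectiveEpi {Y Z : Scheme.{u}} (q : Y ⟶ Z) [EffectiveEpi q]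
    (a : Γ(Y, ⊤)) (ha : ∀ {T : Scheme.{u}} (g₁ g₂ : T ⟶ Y), g₁ ≫ q = g₂ ≫ q →
      g₁.appTop a = g₂.appTop a) : ∃ s, q.appTop s = a := by
  let E := fun X : Scheme.{u} => AffineSpace.toSpecMvPolyIntEquiv PUnit (X := X)
  let l := EffectiveEpi.desc q ((E Y).symm (fun _ => a)) (fun {T} g₁ g₂ hg => by
    refine (E T).injective (funext fun i => ?_)
    rw [AffineSpace.toSpecMvPolyIntEquiv_comp, AffineSpace.toSpecMvPolyIntEquiv_comp]
    simpa [E] using ha g₁ g₂ hg)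
  refine ⟨E Z l PUnit.unit, ?_⟩
  rw [← AffineSpace.toSpecMvPolyIntEquiv_comp, EffectiveEpi.fac]
  simp [E]

lemma Scheme.Hom.appLE_comp_apply {X Y Z : Scheme.{u}} (f : X ⟶ Y) (g : Y ⟶ Z) (U : Z.Opens)
    (V : Y.Opens) (W : X.Opens) (e₁ : V ≤ g ⁻¹ᵁ U) (e₂ : W ≤ f ⁻¹ᵁ V) (a : Γ(Z, U)) :
    (f ≫ g).appLE U W (e₂.trans fun _ hx => e₁ hx) a = f.appLE V W e₂ (g.appLE U V e₁ a) := by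
  rw [← Scheme.Hom.appLE_comp_appLE f g U V W e₁ e₂, CommRingCat.comp_apply]

lemma Scheme.Opens.bijective_ι_appLE {X : Scheme.{u}} (V : X.Opens) :
    Function.Bijective (V.ι.appLE V ⊤ V.ι_preimage_self.ge) := by
  have : V.ι.appLE V ⊤ V.ι_preimage_self.ge = V.topIso.inv := by
    rw [Scheme.Opens.ι_appLE]; rfl
  rw [this]
  exact ConcreteCategory.bijective_of_isIso _

lemma Scheme.Hom.morphismRestrict_appTop_ι_appLE {Y Z : Scheme.{u}} (q : Y ⟶ Z) (V : Z.Opens)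
    (s : Γ(Z, V)) : (q ∣_ V).appTop (V.ι.appLE V ⊤ V.ι_preimage_self.ge s) =
      (q ⁻¹ᵁ V).ι.appLE (q ⁻¹ᵁ V) ⊤ (q ⁻¹ᵁ V).ι_preimage_self.ge (q.app V s) := by
  have h1 : (q ∣_ V).appTop = (q ∣_ V).appLE ⊤ ⊤ le_rfl := ((q ∣_ V).appLE_eq_app).symm
  have h2 := Scheme.Hom.appLE_comp_apply (q ∣_ V) V.ι V ⊤ ⊤ V.ι_preimage_self.ge le_rfl s
  have h3 := Scheme.Hom.appLE_comp_apply (q ⁻¹ᵁ V).ι q V (q ⁻¹ᵁ V) ⊤ le_rfl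
    (q ⁻¹ᵁ V).ι_preimage_self.ge s
  rw [h1, ← h2, ← q.appLE_eq_app, ← h3]
  simp only [morphismRestrict_ι]

lemma Scheme.Hom.injective_app_of_flat {Y Z : Scheme.{u}} (q : Y ⟶ Z) [Flat q] [Surjective q]
    (V : Z.Opens) : Function.Injective (q.app V) := by
  have : Surjective (q ∣_ V) := IsZariskiLocalAtTarget.restrict ‹Surjective q› V
  have : Epi (q ∣_ V) := Flat.epi_of_flat_of_surjective _
  intro a b hab
  refine V.bijective_ι_appLE.1 (Scheme.Hom.injective_appTop_of_epi (q ∣_ V) ?_)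
  rw [q.morphismRestrict_appTop_ι_appLE, q.morphismRestrict_appTop_ι_appLE, hab]

/-- A function on the source of a faithfully flat quasi-compact morphism descends to the target if
it takes the same value at any two points, with values in a scheme, that have the same image. -/
lemma Scheme.Hom.exists_app_eq_of_flat {Y Z : Scheme.{u}} (q : Y ⟶ Z) [Flat q] [Surjective q]
    [QuasiCompact q] (V : Z.Opens) (a : Γ(Y, q ⁻¹ᵁ V))
    (ha : ∀ {T : Scheme.{u}} (g₁ g₂ : T ⟶ Y) (h₁ : ⊤ ≤ g₁ ⁻¹ᵁ q ⁻¹ᵁ V) (h₂ : ⊤ ≤ g₂ ⁻¹ᵁ q ⁻¹ᵁ V),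
      g₁ ≫ q = g₂ ≫ q → g₁.appLE _ ⊤ h₁ a = g₂.appLE _ ⊤ h₂ a) : ∃ s, q.app V s = a := by
  have : Surjective (q ∣_ V) := IsZariskiLocalAtTarget.restrict ‹Surjective q› V
  have : Flat (q ∣_ V) := inferInstance
  have : QuasiCompact (q ∣_ V) := inferInstance
  have h1 {T : Scheme.{u}} (g₁ : T ⟶ ↑(q ⁻¹ᵁ V)) :
      g₁.appTop ((q ⁻¹ᵁ V).ι.appLE (q ⁻¹ᵁ V) ⊤ (q ⁻¹ᵁ V).ι_preimage_self.ge a) =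
      (g₁ ≫ (q ⁻¹ᵁ V).ι).appLE (q ⁻¹ᵁ V) ⊤ (fun x _ => (g₁ x).2) a := by
    have e : g₁.appTop = g₁.appLE ⊤ ⊤ le_rfl := g₁.appLE_eq_app.symm
    rw [e]
    exact (Scheme.Hom.appLE_comp_apply g₁ _ _ ⊤ _ (q ⁻¹ᵁ V).ι_preimage_self.ge le_rfl a).symm
  obtain ⟨s, hs⟩ := Scheme.Hom.exists_appTop_eq_of_effectiveEpi (q ∣_ V)
    ((q ⁻¹ᵁ V).ι.appLE (q ⁻¹ᵁ V) ⊤ (q ⁻¹ᵁ V).ι_preimage_self.ge a) fun {T} g₁ g₂ hg => by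
      rw [h1 g₁, h1 g₂]
      exact ha _ _ _ _ (by simp only [Category.assoc, ← morphismRestrict_ι, reassoc_of% hg])
  obtain ⟨s, rfl⟩ := V.bijective_ι_appLE.2 s
  refine ⟨s, (q ⁻¹ᵁ V).bijective_ι_appLE.1 ?_⟩
  rw [← hs, q.morphismRestrict_appTop_ι_appLE]

/-- If `f, g : R ⇉ Y` factors every pair of morphisms that a faithfully flat quasi-compact
morphism `q` equalizes, then `q` is a geometric quotient of `Y` by `R`. -/
theorem isGeometricQuotient_of_flat {R Y Z : Scheme.{u}} (q : Y ⟶ Z) [Flat q] [QuasiCompact q]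
    [Surjective q] (f g : R ⟶ Y) (w : f ≫ q = g ≫ q)
    (kp : ∀ {T : Scheme.{u}} (a b : T ⟶ Y), a ≫ q = b ≫ q → ∃ r : T ⟶ R, r ≫ f = a ∧ r ≫ g = b) :
    IsGeometricQuotient f.toLRSHom.toShHom.hom g.toLRSHom.toShHom.hom
      q.toLRSHom.toShHom.hom where
  condition := congrArg (fun h : R ⟶ Z => h.toLRSHom.toShHom.hom) w
  isQuotientMap := Flat.isQuotientMap_of_surjective q
  eqvGen x y hxy := by
    obtain ⟨z, rfl, rfl⟩ := Scheme.Pullback.exists_preimage_pullback (f := q) (g := q) x y hxy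
    obtain ⟨r, h₁, h₂⟩ := kp _ _ pullback.condition
    refine .rel _ _ ⟨r z, ?_, ?_⟩
    · rw [← h₁]; rfl
    · rw [← h₂]; rfl
  injective V := by
    rw [PresheafedSpace.secLE_self]
    exact q.injective_app_of_flat V
  exists_section V a ha := by
    rw [PresheafedSpace.secLE_self]
    refine q.exists_app_eq_of_flat V a fun {T} g₁ g₂ hle₁ hle₂ hg => ?_
    obtain ⟨r, rfl, rfl⟩ := kp g₁ g₂ hg
    have hO₂ : f ⁻¹ᵁ q ⁻¹ᵁ V ≤ g ⁻¹ᵁ q ⁻¹ᵁ V := by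
      rw [← Scheme.Hom.comp_preimage, w]; rfl
    have h2 : f.appLE (q ⁻¹ᵁ V) (f ⁻¹ᵁ q ⁻¹ᵁ V) le_rfl a = g.appLE (q ⁻¹ᵁ V) _ hO₂ a :=
      ha (f ⁻¹ᵁ q ⁻¹ᵁ V) le_rfl hO₂
    exact (Scheme.Hom.appLE_comp_apply r f _ _ _ le_rfl hle₁ a).trans
      ((congrArg (r.appLE (f ⁻¹ᵁ q ⁻¹ᵁ V) ⊤ hle₁) h2).trans
        (Scheme.Hom.appLE_comp_apply r g _ _ _ hO₂ hle₁ a).symm)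

end AlgebraicGeometry

/-! ### Invariant affine neighbourhoods -/

namespace AlgebraicGeometry

open TopologicalSpace Opposite

lemma IsAffineOpen.exists_fromSpec_eq {X : Scheme.{u}} {W : X.Opens} (hW : IsAffineOpen W) {y : X}
    (hy : y ∈ W) : ∃ p : PrimeSpectrum Γ(X, W), hW.fromSpec p = y := by
  rw [← SetLike.mem_coe, ← hW.range_fromSpec] at hy
  exact hy

lemma IsAffineOpen.fromSpec_mem_basicOpen_iff {X : Scheme.{u}} {W : X.Opens}
    (hW : IsAffineOpen W) (f : Γ(X, W)) (p : PrimeSpectrum Γ(X, W)) :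
    hW.fromSpec p ∈ X.basicOpen f ↔ f ∉ p.asIdeal := by
  change p ∈ hW.fromSpec ⁻¹ᵁ X.basicOpen f ↔ _
  rw [hW.fromSpec_preimage_basicOpen]; rfl

/-- Prime avoidance: finitely many points of an affine open have arbitrarily small common basic
open neighbourhoods. -/
lemma IsAffineOpen.exists_basicOpen_le_of_finite {X : Scheme.{u}} {W : X.Opens}
    (hW : IsAffineOpen W) {F : Set X} (hF : F.Finite) (hF₀ : F.Nonempty) {V : X.Opens}
    (hFW : F ⊆ W) (hFV : F ⊆ V) : ∃ f : Γ(X, W), X.basicOpen f ≤ V ∧ F ⊆ X.basicOpen f := by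
  let G : Set (PrimeSpectrum Γ(X, W)) := hW.fromSpec ⁻¹' F
  have hG : G.Finite := hF.preimage hW.fromSpec.isOpenEmbedding.injective.injOn
  let Z : Set (PrimeSpectrum Γ(X, W)) := (hW.fromSpec ⁻¹' V)ᶜ
  have hZ : IsClosed Z := (V.isOpen.preimage hW.fromSpec.continuous).isClosed_compl
  let I := PrimeSpectrum.vanishingIdeal Z
  have hI (p) : p ∈ G → ¬ I ≤ p.asIdeal := fun hp hle => by
    have : p ∈ Z := by
      rw [← hZ.closure_eq, ← PrimeSpectrum.zeroLocus_vanishingIdeal_eq_closure]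
      exact hle
    exact this (hFV hp)
  obtain ⟨x, hx⟩ := hF₀
  obtain ⟨p, rfl⟩ := hW.exists_fromSpec_eq (hFW hx)
  have := (Ideal.subset_union_prime_finite hG (f := fun p => p.asIdeal) p p
    (fun i _ _ _ => i.isPrime) (I := I)).not.mpr (by
      rintro ⟨p, hp, hle⟩
      exact hI p hp hle)
  obtain ⟨f, hfI, hf⟩ := Set.not_subset.mp this
  refine ⟨f, fun y hy => ?_, fun y hy => ?_⟩
  · obtain ⟨p, rfl⟩ := hW.exists_fromSpec_eq (X.basicOpen_le f hy)
    by_contra hyV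
    exact (hW.fromSpec_mem_basicOpen_iff f p).mp hy
      ((PrimeSpectrum.mem_vanishingIdeal _ _).mp hfI p hyV)
  · obtain ⟨p, rfl⟩ := hW.exists_fromSpec_eq (hFW hy)
    exact (hW.fromSpec_mem_basicOpen_iff f p).mpr fun h => hf (Set.mem_biUnion (x := p) hy h)

lemma exists_finite_projective_app {R U : Scheme.{u}} (t : R ⟶ U) [IsFinite t] [Flat t]
    [LocallyOfFinitePresentation t] {V : U.Opens} (hV : IsAffineOpen V) :
    letI := (t.app V).hom.toAlgebra
    Module.Finite Γ(U, V) Γ(R, t ⁻¹ᵁ V) ∧ Module.Projective Γ(U, V) Γ(R, t ⁻¹ᵁ V) := by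
  let := (t.app V).hom.toAlgebra
  have h1 : Module.Finite Γ(U, V) Γ(R, t ⁻¹ᵁ V) := t.finite_app V hV
  have hV' : IsAffineOpen (t ⁻¹ᵁ V) := hV.preimage t
  have h2 : Algebra.FinitePresentation Γ(U, V) Γ(R, t ⁻¹ᵁ V) := by
    have := t.finitePresentation_appLE hV hV' le_rfl
    rwa [t.appLE_eq_app] at this
  have h3 : Module.Flat Γ(U, V) Γ(R, t ⁻¹ᵁ V) := by
    have := t.flat_appLE hV hV' le_rfl
    rwa [t.appLE_eq_app] at this
  have := Module.FinitePresentation.of_finite_of_finitePresentation Γ(U, V) Γ(R, t ⁻¹ᵁ V)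
  exact ⟨h1, Module.Flat.projective_of_finitePresentation⟩

/-- The norm of a function along a finite locally free morphism is invertible exactly at the points
over which the function has no zeros. -/
lemma exists_mem_basicOpen_iff_forall {R U : Scheme.{u}} (t : R ⟶ U) [IsFinite t] [Flat t]
    [LocallyOfFinitePresentation t] {V : U.Opens} (hV : IsAffineOpen V) (b : Γ(R, t ⁻¹ᵁ V)) :
    ∃ a : Γ(U, V), ∀ y ∈ V, y ∈ U.basicOpen a ↔ ∀ r, t r = y → r ∈ R.basicOpen b := by
  let := (t.app V).hom.toAlgebra
  obtain ⟨_, _⟩ := exists_finite_projective_app t hV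
  obtain ⟨a, ha⟩ := exists_norm (A := Γ(U, V)) b
  have hV' : IsAffineOpen (t ⁻¹ᵁ V) := hV.preimage t
  have hcomp (P : PrimeSpectrum Γ(R, t ⁻¹ᵁ V)) :
      hV.fromSpec (P.comap (algebraMap Γ(U, V) Γ(R, t ⁻¹ᵁ V))) = t (hV'.fromSpec P) := by
    have := hV.SpecMap_appLE_fromSpec t hV' le_rfl
    rw [t.appLE_eq_app] at this
    exact congrArg (fun h : Spec _ ⟶ U => h P) this
  refine ⟨a, fun y hy => ?_⟩
  obtain ⟨q, rfl⟩ := hV.exists_fromSpec_eq hy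
  refine (hV.fromSpec_mem_basicOpen_iff a q).trans ((ha q).not.trans ?_)
  constructor
  · intro hq r hr
    obtain ⟨P, rfl⟩ := hV'.exists_fromSpec_eq (y := r) (show t r ∈ V by rwa [hr])
    refine (hV'.fromSpec_mem_basicOpen_iff b P).mpr ?_
    intro hP
    rw [← hcomp] at hr
    exact hq ⟨P, hV.fromSpec.isOpenEmbedding.injective hr, hP⟩
  · rintro hr ⟨P, rfl, hP⟩
    exact (hV'.fromSpec_mem_basicOpen_iff b P).mp (hr _ (hcomp P).symm) hP

end AlgebraicGeometry

namespace IsEquivRel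

section

variable {C : Type w} [Category.{v} C] {R X : C} {s t : R ⟶ X}

lemma exists_refl (h : IsEquivRel s t) : ∃ e : X ⟶ R, e ≫ s = 𝟙 X ∧ e ≫ t = 𝟙 X :=
  (h.equivalence X).refl (𝟙 X)

lemma exists_symm (h : IsEquivRel s t) {T : C} (r : T ⟶ R) :
    ∃ r' : T ⟶ R, r' ≫ s = r ≫ t ∧ r' ≫ t = r ≫ s :=
  (h.equivalence T).symm ⟨r, rfl, rfl⟩

lemma exists_trans (h : IsEquivRel s t) {T : C} (r r' : T ⟶ R) (w : r ≫ t = r' ≫ s) :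
    ∃ r'' : T ⟶ R, r'' ≫ s = r ≫ s ∧ r'' ≫ t = r' ≫ t :=
  (h.equivalence T).trans ⟨r, rfl, w⟩ ⟨r', rfl, rfl⟩

lemma isPullback_of_forall_exists (h : IsEquivRel s t) {Q : C} {π : X ⟶ Q} (w : s ≫ π = t ≫ π)
    (H : ∀ {T : C} (a b : T ⟶ X), a ≫ π = b ≫ π → ∃ m : T ⟶ R, m ≫ s = a ∧ m ≫ t = b) :
    IsPullback s t π π :=
  ⟨⟨w⟩, ⟨PullbackCone.IsLimit.mk _ (fun c => (H c.fst c.snd c.condition).choose)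
    (fun c => (H c.fst c.snd c.condition).choose_spec.1)
    (fun c => (H c.fst c.snd c.condition).choose_spec.2)
    fun c _ h₁ h₂ => h.injective _ _ (h₁.trans (H c.fst c.snd c.condition).choose_spec.1.symm)
      (h₂.trans (H c.fst c.snd c.condition).choose_spec.2.symm)⟩⟩

end

variable {R U : Scheme.{u}} {s t : R ⟶ U} (h : IsEquivRel s t)

include h

lemma equivalence_points : Equivalence fun x y : U => ∃ r : R, s r = x ∧ t r = y where
  refl x := by
    obtain ⟨e, h₁, h₂⟩ := h.exists_refl
    exact ⟨e x, congrArg (fun f : U ⟶ U => f x) h₁, congrArg (fun f : U ⟶ U => f x) h₂⟩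
  symm := by
    rintro _ _ ⟨r, rfl, rfl⟩
    obtain ⟨σ, h₁, h₂⟩ := h.exists_symm (𝟙 R)
    exact ⟨σ r, congrArg (fun f : R ⟶ U => f r) h₁, congrArg (fun f : R ⟶ U => f r) h₂⟩
  trans := by
    rintro _ _ _ ⟨r, rfl, rfl⟩ ⟨r', hr, rfl⟩
    obtain ⟨z, rfl, rfl⟩ := Scheme.Pullback.exists_preimage_pullback (f := t) (g := s) r r' hr.symm
    obtain ⟨m, h₁, h₂⟩ := h.exists_trans (pullback.fst t s) (pullback.snd t s) pullback.condition
    exact ⟨m z, congrArg (fun f : pullback t s ⟶ U => f z) h₁,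
      congrArg (fun f : pullback t s ⟶ U => f z) h₂⟩

/-- If `t` is closed, the points whose class lies in a given open form an invariant open. -/
lemma exists_invariant_open (ht : IsClosedMap t) (O : U.Opens) : ∃ O' : U.Opens,
    O' ≤ O ∧ s ⁻¹ᵁ O' = t ⁻¹ᵁ O' ∧ ∀ y, y ∈ O' ↔ ∀ r, t r = y → s r ∈ O := by
  let O' : U.Opens := ⟨(t '' ((s ⁻¹ᵁ O : R.Opens) : Set R)ᶜ)ᶜ,
    (ht _ (s ⁻¹ᵁ O).isOpen.isClosed_compl).isOpen_compl⟩
  have hO' (y) : y ∈ O' ↔ ∀ r, t r = y → s r ∈ O := by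
    change ¬ (∃ r, ¬ (s r ∈ O) ∧ t r = y) ↔ _
    grind
  have heq := h.equivalence_points
  refine ⟨O', fun y hy => ?_, ?_, hO'⟩
  · obtain ⟨r, h₁, h₂⟩ := heq.refl y
    exact h₁ ▸ (hO' y).mp hy r h₂
  · ext r
    change s r ∈ O' ↔ t r ∈ O'
    rw [hO', hO']
    constructor
    · intro H r' hr'
      obtain ⟨r'', h₁, h₂⟩ := heq.trans ⟨r', rfl, hr'⟩ (heq.symm ⟨r, rfl, rfl⟩)
      exact h₁ ▸ H r'' h₂
    · intro H r' hr'
      obtain ⟨r'', h₁, h₂⟩ := heq.trans ⟨r', rfl, hr'⟩ ⟨r, rfl, rfl⟩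
      exact h₁ ▸ H r'' h₂

/-- A point whose class lies in an affine open has arbitrarily small invariant affine
neighbourhoods of its class. -/
theorem exists_invariant_affine [IsFinite t] [Flat t] [LocallyOfFinitePresentation t] (x : U)
    {W₀ : U.Opens} (hW₀ : IsAffineOpen W₀) (hx₀ : ∀ r, t r = x → s r ∈ W₀)
    (O : U.Opens) (hx : ∀ r, t r = x → s r ∈ O) :
    ∃ W : U.Opens, IsAffineOpen W ∧ s ⁻¹ᵁ W = t ⁻¹ᵁ W ∧ x ∈ W ∧ W ≤ O := by
  obtain ⟨O₁, hO₁, hinv, hmem⟩ := h.exists_invariant_open t.isClosedMap (W₀ ⊓ O)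
  have heq := h.equivalence_points
  have hxO₁ : x ∈ O₁ := (hmem x).mpr fun r hr => ⟨hx₀ r hr, hx r hr⟩
  have horb (r : R) (hr : t r = x) : s r ∈ O₁ := by
    change r ∈ s ⁻¹ᵁ O₁
    rw [hinv]
    change t r ∈ O₁
    rwa [hr]
  obtain ⟨f, hfO₁, hf⟩ := hW₀.exists_basicOpen_le_of_finite (F := s '' (t ⁻¹' {x})) (V := O₁)
    ((t.finite_preimage_singleton x).image s) (by
      obtain ⟨r, h₁, h₂⟩ := heq.refl x
      exact ⟨_, r, h₂, rfl⟩)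
    (by rintro _ ⟨r, hr, rfl⟩; exact hx₀ r hr) (by rintro _ ⟨r, hr, rfl⟩; exact horb r hr)
  have hV : IsAffineOpen (U.basicOpen f) := hW₀.basicOpen f
  have hle : t ⁻¹ᵁ U.basicOpen f ≤ s ⁻¹ᵁ W₀ := fun r hr => by
    have h1 : r ∈ t ⁻¹ᵁ O₁ := hfO₁ hr
    rw [← hinv] at h1
    exact (hO₁ h1).1
  obtain ⟨a, ha⟩ := exists_mem_basicOpen_iff_forall t hV (s.appLE W₀ _ hle f)
  have ha' (y) (hy : y ∈ U.basicOpen f) :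
      y ∈ U.basicOpen a ↔ ∀ r, t r = y → s r ∈ U.basicOpen f := by
    rw [ha y hy]
    refine forall₂_congr fun r hr => ?_
    rw [Scheme.basicOpen_appLE]
    exact ⟨fun h => h.2, fun h => ⟨show t r ∈ U.basicOpen f by rwa [hr], h⟩⟩
  refine ⟨U.basicOpen a, hV.basicOpen a, ?_, ?_, ?_⟩
  · have key (y) : y ∈ U.basicOpen a ↔ ∀ r, t r = y → s r ∈ U.basicOpen f := by
      refine ⟨fun hy => (ha' y (U.basicOpen_le a hy)).mp hy, fun H => (ha' y ?_).mpr H⟩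
      obtain ⟨r, h₁, h₂⟩ := heq.refl y
      exact h₁ ▸ H r h₂
    ext r
    change s r ∈ U.basicOpen a ↔ t r ∈ U.basicOpen a
    rw [key, key]
    constructor
    · intro H r' hr'
      obtain ⟨r'', h₁, h₂⟩ := heq.trans ⟨r', rfl, hr'⟩ (heq.symm ⟨r, rfl, rfl⟩)
      exact h₁ ▸ H r'' h₂
    · intro H r' hr'
      obtain ⟨r'', h₁, h₂⟩ := heq.trans ⟨r', rfl, hr'⟩ ⟨r, rfl, rfl⟩
      exact h₁ ▸ H r'' h₂
  · have hxf : x ∈ U.basicOpen f := by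
      obtain ⟨r, h₁, h₂⟩ := heq.refl x
      exact h₁ ▸ hf ⟨r, h₂, rfl⟩
    exact (ha' x hxf).mpr fun r hr => hf ⟨r, hr, rfl⟩
  · exact (U.basicOpen_le a).trans (hfO₁.trans (hO₁.trans inf_le_right))

end IsEquivRel

/-! ### Good affine charts -/

namespace AlgebraicGeometry

open TopologicalSpace Opposite TensorProduct

section

variable {R U : Scheme.{u}} {t : R ⟶ U} {W : U.Opens} {W' : R.Opens}

/-- Spectra mapping into an affine open. -/
lemma IsAffineOpen.exists_SpecMap_fromSpec_eq (hW' : IsAffineOpen W') {T : CommRingCat.{u}}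
    (m : Spec T ⟶ R) (hm : ∀ x, m x ∈ W') :
    ∃ φ : Γ(R, W') ⟶ T, Spec.map φ ≫ hW'.fromSpec = m := by
  refine ⟨Spec.preimage (IsOpenImmersion.lift hW'.fromSpec m ?_), ?_⟩
  · rw [hW'.range_fromSpec]
    rintro _ ⟨x, rfl⟩
    exact hm x
  · rw [Spec.map_preimage, IsOpenImmersion.lift_fac]

lemma IsAffineOpen.SpecMap_fromSpec_mem (hW' : IsAffineOpen W') {T : CommRingCat.{u}}
    (φ : Γ(R, W') ⟶ T) (x : Spec T) : (Spec.map φ ≫ hW'.fromSpec) x ∈ W' := by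
  rw [← SetLike.mem_coe, ← hW'.range_fromSpec]
  exact ⟨_, rfl⟩

lemma IsAffineOpen.SpecMap_fromSpec_injective (hW' : IsAffineOpen W') {T : CommRingCat.{u}}
    {φ ψ : Γ(R, W') ⟶ T} (h : Spec.map φ ≫ hW'.fromSpec = Spec.map ψ ≫ hW'.fromSpec) : φ = ψ :=
  Spec.map_injective ((cancel_mono hW'.fromSpec).mp h)

lemma IsAffineOpen.SpecMap_appLE_comp_fromSpec (hW : IsAffineOpen W) (hW' : IsAffineOpen W')
    (hle : W' ≤ t ⁻¹ᵁ W) {T : CommRingCat.{u}} (φ : Γ(R, W') ⟶ T) :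
    Spec.map (t.appLE W W' hle ≫ φ) ≫ hW.fromSpec = (Spec.map φ ≫ hW'.fromSpec) ≫ t := by
  rw [Spec.map_comp, Category.assoc, hW.SpecMap_appLE_fromSpec t hW', Category.assoc]

/-- Restricting an affine morphism over smaller affine opens is a base change. -/
lemma isPushout_app_of_le [IsAffineHom t] {V : U.Opens} (hW : IsAffineOpen W)
    (hV : IsAffineOpen V) (hVW : V ≤ W) :
    IsPushout (U.presheaf.map (homOfLE hVW).op) (t.appLE W (t ⁻¹ᵁ W) le_rfl)
      (t.appLE V (t ⁻¹ᵁ V) le_rfl)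
      (R.presheaf.map (homOfLE (show t ⁻¹ᵁ V ≤ t ⁻¹ᵁ W from fun _ hx => hVW hx)).op) := by
  have hle : t ⁻¹ᵁ V ≤ t ⁻¹ᵁ W := fun _ hx => hVW hx
  have hW' := hW.preimage t
  have hV' := hV.preimage t
  have w : U.presheaf.map (homOfLE hVW).op ≫ t.appLE V (t ⁻¹ᵁ V) le_rfl =
      t.appLE W (t ⁻¹ᵁ W) le_rfl ≫ R.presheaf.map (homOfLE hle).op := by
    rw [Scheme.Hom.map_appLE, Scheme.Hom.appLE_map]
  have hd (c : PushoutCocone (U.presheaf.map (homOfLE hVW).op) (t.appLE W (t ⁻¹ᵁ W) le_rfl)) :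
      ∃ χ : Γ(R, t ⁻¹ᵁ V) ⟶ c.pt, t.appLE V (t ⁻¹ᵁ V) le_rfl ≫ χ = c.inl ∧
        R.presheaf.map (homOfLE hle).op ≫ χ = c.inr := by
    have h1 : (Spec.map c.inr ≫ hW'.fromSpec) ≫ t = Spec.map c.inl ≫ hV.fromSpec := by
      rw [← IsAffineOpen.SpecMap_appLE_comp_fromSpec hW hW' le_rfl, ← c.condition, Spec.map_comp,
        Category.assoc, hW.map_fromSpec hV]
    obtain ⟨χ, hχ⟩ := hV'.exists_SpecMap_fromSpec_eq (Spec.map c.inr ≫ hW'.fromSpec) fun x => by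
      change ((Spec.map c.inr ≫ hW'.fromSpec) ≫ t) x ∈ V
      rw [h1]
      exact hV.SpecMap_fromSpec_mem c.inl x
    refine ⟨χ, hV.SpecMap_fromSpec_injective ?_, hW'.SpecMap_fromSpec_injective ?_⟩
    · rw [IsAffineOpen.SpecMap_appLE_comp_fromSpec hV hV', hχ, h1]
    · rw [Spec.map_comp, Category.assoc, hW'.map_fromSpec hV', hχ]
  choose d hd₁ hd₂ using hd
  refine ⟨⟨w⟩, ⟨PushoutCocone.IsColimit.mk _ d hd₁ hd₂ fun c m _ hm => ?_⟩⟩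
  apply hV'.SpecMap_fromSpec_injective
  rw [← hW'.map_fromSpec hV' (homOfLE hle).op, ← Category.assoc, ← Category.assoc,
    ← Spec.map_comp, ← Spec.map_comp, hm, hd₂]

end

end AlgebraicGeometry

namespace IsEquivRel

open AlgebraicGeometry

variable {R U : Scheme.{u}} {s t : R ⟶ U} (h : IsEquivRel s t) {W : U.Opens}

include h

/-- An equivalence relation restricts to every invariant affine open. -/
lemma isRingEquivRel [IsAffineHom t] (hW : IsAffineOpen W) (hinv : s ⁻¹ᵁ W = t ⁻¹ᵁ W) :
    IsRingEquivRel (s.appLE W (t ⁻¹ᵁ W) hinv.ge).hom (t.appLE W (t ⁻¹ᵁ W) le_rfl).hom := by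
  have hW' := hW.preimage t
  have ext {T : CommRingCat.{u}} {α β : Γ(U, W) ⟶ T}
      (h : Spec.map α ≫ hW.fromSpec = Spec.map β ≫ hW.fromSpec) : α.hom = β.hom :=
    congrArg CommRingCat.Hom.hom (hW.SpecMap_fromSpec_injective h)
  have es {T : CommRingCat.{u}} (φ : Γ(R, t ⁻¹ᵁ W) ⟶ T) :=
    IsAffineOpen.SpecMap_appLE_comp_fromSpec (t := s) hW hW' hinv.ge φ
  have et {T : CommRingCat.{u}} (φ : Γ(R, t ⁻¹ᵁ W) ⟶ T) :=
    IsAffineOpen.SpecMap_appLE_comp_fromSpec (t := t) hW hW' le_rfl φ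
  -- an equivalence between points of `W` is a point of `t ⁻¹ W`
  have key {T : CommRingCat.{u}} (α : Γ(U, W) ⟶ T) (m : Spec T ⟶ R)
      (hm : m ≫ t = Spec.map α ≫ hW.fromSpec) :
      ∃ χ : Γ(R, t ⁻¹ᵁ W) ⟶ T, Spec.map χ ≫ hW'.fromSpec = m := by
    refine hW'.exists_SpecMap_fromSpec_eq m fun x => ?_
    change (m ≫ t) x ∈ W
    rw [hm]
    exact hW.SpecMap_fromSpec_mem α x
  constructor
  · intro T _ φ ψ h₁ h₂
    let φ' : Γ(R, t ⁻¹ᵁ W) ⟶ CommRingCat.of T := CommRingCat.ofHom φ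
    let ψ' : Γ(R, t ⁻¹ᵁ W) ⟶ CommRingCat.of T := CommRingCat.ofHom ψ
    suffices φ' = ψ' from congrArg CommRingCat.Hom.hom this
    refine hW'.SpecMap_fromSpec_injective (h.injective _ _ ?_ ?_)
    · rw [← es, ← es, CommRingCat.hom_ext (f := s.appLE W _ hinv.ge ≫ φ') (g := _ ≫ ψ') h₁]
    · rw [← et, ← et, CommRingCat.hom_ext (f := t.appLE W _ le_rfl ≫ φ') (g := _ ≫ ψ') h₂]
  · obtain ⟨e, h₁, h₂⟩ := h.exists_refl
    obtain ⟨χ, hχ⟩ := key (𝟙 _) (hW.fromSpec ≫ e) (by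
      rw [Category.assoc, h₂, Spec.map_id, Category.comp_id, Category.id_comp])
    refine ⟨χ.hom, ext (α := _ ≫ χ) (β := 𝟙 _) ?_, ext (α := _ ≫ χ) (β := 𝟙 _) ?_⟩
    · rw [es, hχ, Category.assoc, h₁, Spec.map_id, Category.comp_id, Category.id_comp]
    · rw [et, hχ, Category.assoc, h₂, Spec.map_id, Category.comp_id, Category.id_comp]
  · intro T _ φ
    let φ' : Γ(R, t ⁻¹ᵁ W) ⟶ CommRingCat.of T := CommRingCat.ofHom φ
    obtain ⟨m, h₁, h₂⟩ := h.exists_symm (Spec.map φ' ≫ hW'.fromSpec)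
    obtain ⟨χ, hχ⟩ := key _ m (h₂.trans (es φ').symm)
    refine ⟨χ.hom, ext (α := _ ≫ χ) (β := _ ≫ φ') ?_, ext (α := _ ≫ χ) (β := _ ≫ φ') ?_⟩
    · rw [es, hχ, h₁, et]
    · rw [et, hχ, h₂, es]
  · intro T _ φ ψ w
    let φ' : Γ(R, t ⁻¹ᵁ W) ⟶ CommRingCat.of T := CommRingCat.ofHom φ
    let ψ' : Γ(R, t ⁻¹ᵁ W) ⟶ CommRingCat.of T := CommRingCat.ofHom ψ
    obtain ⟨m, h₁, h₂⟩ := h.exists_trans (Spec.map φ' ≫ hW'.fromSpec)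
      (Spec.map ψ' ≫ hW'.fromSpec) (by
        rw [← es, ← et,
          CommRingCat.hom_ext (f := t.appLE W _ le_rfl ≫ φ') (g := s.appLE W _ hinv.ge ≫ ψ') w])
    obtain ⟨χ, hχ⟩ := key _ m (h₂.trans (et ψ').symm)
    refine ⟨χ.hom, ext (α := _ ≫ χ) (β := _ ≫ φ') ?_, ext (α := _ ≫ χ) (β := _ ≫ ψ') ?_⟩
    · rw [es, hχ, h₁, es]
    · rw [et, hχ, h₂, et]

/-- Every point whose class lies in an affine open has an invariant affine neighbourhood `W` such
that functions pulled back along `s` form a basis of the functions on `t ⁻¹ W`. -/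
theorem exists_invariant_affine_basis [IsFinite t] [Flat t] [LocallyOfFinitePresentation t] (x : U)
    {W₀ : U.Opens} (hW₀ : IsAffineOpen W₀) (hx₀ : ∀ r, t r = x → s r ∈ W₀) :
    ∃ W : U.Opens, IsAffineOpen W ∧ x ∈ W ∧ ∃ (hinv : s ⁻¹ᵁ W = t ⁻¹ᵁ W) (n : ℕ)
      (a : Fin n → Γ(U, W)), letI := (t.appLE W (t ⁻¹ᵁ W) le_rfl).hom.toAlgebra
        ∃ b : Module.Basis (Fin n) Γ(U, W) Γ(R, t ⁻¹ᵁ W),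
          ∀ j, b j = s.appLE W (t ⁻¹ᵁ W) hinv.ge (a j) := by
  obtain ⟨W, hW, hinv, hxW, -⟩ := h.exists_invariant_affine x hW₀ hx₀ W₀ hx₀
  have hW' := hW.preimage t
  let A := Γ(U, W)
  let B := Γ(R, t ⁻¹ᵁ W)
  let sW : A →+* B := (s.appLE W (t ⁻¹ᵁ W) hinv.ge).hom
  let := (t.appLE W (t ⁻¹ᵁ W) le_rfl).hom.toAlgebra
  obtain ⟨_, _⟩ : Module.Finite A B ∧ Module.Projective A B := by
    have := exists_finite_projective_app t hW
    rwa [← t.appLE_eq_app] at this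
  have hr : IsRingEquivRel sW (algebraMap A B) := h.isRingEquivRel hW hinv
  obtain ⟨q, hq⟩ := hW.exists_fromSpec_eq hxW
  -- functions pulled back along `s` that form a basis of the fibre over `x`, hence nearby
  obtain ⟨n, v, hv, hb⟩ := exists_isFiberBasis_of_span_eq_top hr.span_range_eq_top
    q.asIdeal.ResidueField
  choose a ha using hv
  obtain rfl : (fun j => sW (a j)) = v := funext ha
  let O : U.Opens := hW.fromSpec ''ᵁ
    ⟨_, isOpen_setOf_isFiberBasis (A := A) (fun j => sW (a j))⟩
  have hmem (p : PrimeSpectrum A) : hW.fromSpec p ∈ O ↔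
      IsFiberBasis A (fun j => sW (a j)) p.asIdeal.ResidueField :=
    hW.fromSpec.isOpenEmbedding.injective.mem_set_image
  have hcomp (f : R ⟶ U) (hf : t ⁻¹ᵁ W ≤ f ⁻¹ᵁ W) (P : PrimeSpectrum B) :
      hW.fromSpec (P.comap (f.appLE W (t ⁻¹ᵁ W) hf).hom) = f (hW'.fromSpec P) :=
    congrArg (fun h : Spec _ ⟶ U => h P) (hW.SpecMap_appLE_fromSpec f hW' hf)
  have hxO (r : R) (hr' : t r = x) : s r ∈ O := by
    obtain ⟨r', hs, ht⟩ := h.equivalence_points.symm ⟨r, rfl, hr'⟩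
    obtain ⟨P, rfl⟩ := hW'.exists_fromSpec_eq (y := r') (by
      rw [← hinv]
      change s r' ∈ W
      rwa [hs])
    rw [← ht, ← hcomp t le_rfl]
    rw [← hs, ← hcomp s hinv.ge] at hq
    refine (hmem _).mpr (hr.isFiberBasis_comap P ?_)
    rwa [hW.fromSpec.isOpenEmbedding.injective hq] at hb
  have hxW' (r : R) (hr' : t r = x) : s r ∈ W := by
    change r ∈ s ⁻¹ᵁ W
    rw [hinv]
    change t r ∈ W
    rwa [hr']
  obtain ⟨V, hV, hinvV, hxV, hVO⟩ := h.exists_invariant_affine x hW hxW' O hxO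
  have hVW : V ≤ W := hVO.trans (by
    rintro _ ⟨p, _, rfl⟩
    exact hW.range_fromSpec.le ⟨p, rfl⟩)
  have hle : t ⁻¹ᵁ V ≤ t ⁻¹ᵁ W := fun _ hx => hVW hx
  refine ⟨V, hV, hxV, hinvV, n, fun j => U.presheaf.map (homOfLE hVW).op (a j), ?_⟩
  let A' := Γ(U, V)
  let B' := Γ(R, t ⁻¹ᵁ V)
  let := (t.appLE V (t ⁻¹ᵁ V) le_rfl).hom.toAlgebra
  let : Algebra A A' := (U.presheaf.map (homOfLE hVW).op).hom.toAlgebra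
  let : Algebra B B' := (R.presheaf.map (homOfLE hle).op).hom.toAlgebra
  let : Algebra A B' := ((algebraMap B B').comp (algebraMap A B)).toAlgebra
  have hpush := isPushout_app_of_le (t := t) hW hV hVW
  have : IsScalarTower A B B' := .of_algebraMap_eq fun _ => rfl
  have : IsScalarTower A A' B' := .of_algebraMap_eq fun x =>
    (ConcreteCategory.congr_hom hpush.w x).symm
  have : Algebra.IsPushout A A' B B' := CommRingCat.isPushout_iff_isPushout.mp hpush
  obtain ⟨_, _⟩ : Module.Finite A' B' ∧ Module.Projective A' B' := by
    have := exists_finite_projective_app t hV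
    rwa [← t.appLE_eq_app] at this
  obtain ⟨b, hb'⟩ := exists_basis_of_isPushout (A' := A') (B' := B') (fun j => sW (a j))
    fun p => (hmem _).mp (hVO (by
      have : hW.fromSpec (p.comap (algebraMap A A')) = hV.fromSpec p :=
        congrArg (fun h : Spec _ ⟶ U => h p) (hW.map_fromSpec hV (homOfLE hVW).op)
      rw [this]
      exact hV.range_fromSpec.le ⟨p, rfl⟩))
  refine ⟨b, fun j => (hb' j).trans ?_⟩
  have h1 : s.appLE W (t ⁻¹ᵁ W) hinv.ge ≫ R.presheaf.map (homOfLE hle).op =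
      U.presheaf.map (homOfLE hVW).op ≫ s.appLE V (t ⁻¹ᵁ V) hinvV.ge := by
    rw [Scheme.Hom.map_appLE, Scheme.Hom.appLE_map]
  exact ConcreteCategory.congr_hom h1 (a j)

end IsEquivRel

namespace IsEquivRel

open AlgebraicGeometry

section Charts

variable {R U : Scheme.{u}} {s t : R ⟶ U} (h : IsEquivRel s t) [IsFinite t] [Flat t]
  [LocallyOfFinitePresentation t]

include h

/-- Every point whose class lies in an affine open has an invariant affine neighbourhood on which
the equivalence relation is the kernel pair of a finite locally free morphism. -/
theorem exists_isPushout (x : U) {W₀ : U.Opens} (hW₀ : IsAffineOpen W₀)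
    (hx₀ : ∀ r, t r = x → s r ∈ W₀) :
    ∃ W : U.Opens, IsAffineOpen W ∧ x ∈ W ∧ ∃ (hinv : s ⁻¹ᵁ W = t ⁻¹ᵁ W) (C : CommRingCat.{u})
      (c : C ⟶ Γ(U, W)), (IsFinite (Spec.map c) ∧ Flat (Spec.map c) ∧
        LocallyOfFinitePresentation (Spec.map c) ∧ Surjective (Spec.map c)) ∧
      IsPullback (Spec.map (s.appLE W (t ⁻¹ᵁ W) hinv.ge)) (Spec.map (t.appLE W (t ⁻¹ᵁ W) le_rfl))
        (Spec.map c) (Spec.map c) := by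
  obtain ⟨W, hW, hxW, hinv, n, a, b, hb⟩ := h.exists_invariant_affine_basis x hW₀ hx₀
  let := (t.appLE W (t ⁻¹ᵁ W) le_rfl).hom.toAlgebra
  have hr : IsRingEquivRel (s.appLE W (t ⁻¹ᵁ W) hinv.ge).hom
    (algebraMap Γ(U, W) Γ(R, t ⁻¹ᵁ W)) := h.isRingEquivRel hW hinv
  let C : Subring Γ(U, W) := (s.appLE W (t ⁻¹ᵁ W) hinv.ge).hom.eqLocus
    (algebraMap Γ(U, W) Γ(R, t ⁻¹ᵁ W))
  obtain ⟨b', -⟩ := hr.exists_basis_eqLocus b hb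
  have hpush := hr.isPushout_eqLocus b hb
  have : Module.Free C Γ(U, W) := .of_basis b'
  have : Module.Finite C Γ(U, W) := .of_basis b'
  have : Module.FinitePresentation C Γ(U, W) := Module.finitePresentation_of_projective _ _
  let c : CommRingCat.of C ⟶ Γ(U, W) := CommRingCat.ofHom C.subtype
  refine ⟨W, hW, hxW, hinv, CommRingCat.of C, c, ⟨?_, ?_, ?_, ?_⟩, ?_⟩
  · rw [IsFinite.SpecMap_iff]
    exact RingHom.finite_algebraMap.mpr ‹_›
  · rw [Flat.SpecMap_iff]
    exact RingHom.flat_algebraMap_iff.mpr inferInstance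
  · rw [LocallyOfFinitePresentation.SpecMap_iff]
    exact RingHom.finitePresentation_algebraMap.mpr inferInstance
  · refine ⟨PrimeSpectrum.comap_surjective_iff_injective_of_finite.mpr ?_⟩
    exact Subtype.val_injective
  · exact (isPullback_SpecMap_of_isPushout _ _ _ _ hpush).flip

end Charts

end IsEquivRel

/-! ### Quotients by finite locally free equivalence relations -/

namespace IsEquivRel

open AlgebraicGeometry

variable {R U : Scheme.{u}} {s t : R ⟶ U} (h : IsEquivRel s t)

/-- If the relation on an invariant affine open `W` is the kernel pair of a faithfully flat morphism
to `Spec C`, then `Spec C` is an open subspace of the coequalizer of locally ringed spaces. -/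
lemma exists_openImmersion_coequalizer {W : U.Opens} (hW : IsAffineOpen W) [IsAffineHom t]
    (hinv : s ⁻¹ᵁ W = t ⁻¹ᵁ W) {C : CommRingCat.{u}} (c : C ⟶ Γ(U, W)) [Flat (Spec.map c)]
    [Surjective (Spec.map c)]
    (hpb : IsPullback (Spec.map (s.appLE W (t ⁻¹ᵁ W) hinv.ge))
      (Spec.map (t.appLE W (t ⁻¹ᵁ W) le_rfl)) (Spec.map c) (Spec.map c)) :
    ∃ j : (Spec C).toLocallyRingedSpace ⟶
        (LocallyRingedSpace.coequalizerCofork s.toLRSHom t.toLRSHom).pt,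
      LocallyRingedSpace.IsOpenImmersion j ∧ (Spec.map c).toLRSHom ≫ j =
        hW.fromSpec.toLRSHom ≫
          (LocallyRingedSpace.coequalizerCofork s.toLRSHom t.toLRSHom).π := by
  let c₀ := LocallyRingedSpace.coequalizerCofork s.toLRSHom t.toLRSHom
  have hW' := hW.preimage t
  have hs := hW.SpecMap_appLE_fromSpec s hW' hinv.ge
  have ht := hW.SpecMap_appLE_fromSpec t hW' le_rfl
  have H := IsGeometricQuotient.coequalizerCofork s.toLRSHom t.toLRSHom
  have H' := isGeometricQuotient_of_flat (Spec.map c) _ _ hpb.w fun a b hab =>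
    ⟨hpb.lift a b hab, hpb.lift_fst _ _ _, hpb.lift_snd _ _ _⟩
  obtain ⟨w, ⟨hc⟩⟩ := IsGeometricQuotient.isCoequalizerOf H'
  have hs' := congrArg Scheme.Hom.toLRSHom hs
  have ht' := congrArg Scheme.Hom.toLRSHom ht
  simp only [Scheme.Hom.comp_toLRSHom] at hs' ht'
  obtain ⟨j, hj⟩ := Cofork.IsColimit.desc' hc (hW.fromSpec.toLRSHom ≫ c₀.π) (by
    rw [reassoc_of% hs', reassoc_of% ht', c₀.condition])
  refine ⟨j, ?_, hj⟩
  have hrange : (t ⁻¹ᵁ W : Set R) = Set.range hW'.fromSpec := hW'.range_fromSpec.symm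
  refine IsGeometricQuotient.isOpenImmersion (j := hW.fromSpec.toLRSHom.toShHom.hom)
    (k := hW'.fromSpec.toLRSHom.toShHom.hom) H H' ?_ ?_ ?_ ?_ ?_
  · exact congrArg (fun h : _ ⟶ U => h.toLRSHom.toShHom.hom) hs.symm
  · exact congrArg (fun h : _ ⟶ U => h.toLRSHom.toShHom.hom) ht.symm
  · rintro r ⟨y, hy⟩
    refine hrange.le ?_
    rw [← hinv]
    exact hW.range_fromSpec.le ⟨y, hy⟩
  · rintro r ⟨y, hy⟩
    refine hrange.le ?_
    exact hW.range_fromSpec.le ⟨y, hy⟩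
  · exact congrArg (fun h : _ ⟶ c₀.pt => h.toShHom.hom) hj

end IsEquivRel

namespace AlgebraicGeometry

/-- A pair of morphisms factors through a joint monomorphism as soon as it does locally. -/
lemma exists_lift_of_forall_exists {R U T : Scheme.{u}} {s t : R ⟶ U}
    (hinj : ∀ ⦃T : Scheme.{u}⦄ (r r' : T ⟶ R), r ≫ s = r' ≫ s → r ≫ t = r' ≫ t → r = r')
    (a b : T ⟶ U) (H : ∀ x : T, ∃ (O : T.Opens) (r : O.toScheme ⟶ R), x ∈ O ∧ r ≫ s = O.ι ≫ a ∧
      r ≫ t = O.ι ≫ b) : ∃ r : T ⟶ R, r ≫ s = a ∧ r ≫ t = b := by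
  choose O r hxO hs ht using H
  let 𝒰 := T.openCoverOfIsOpenCover O (by
    rw [TopologicalSpace.IsOpenCover, eq_top_iff]
    exact fun x _ => TopologicalSpace.Opens.mem_iSup.mpr ⟨x, hxO x⟩)
  have hr (x y : T) : pullback.fst (O x).ι (O y).ι ≫ r x = pullback.snd (O x).ι (O y).ι ≫ r y := by
    apply hinj
    · rw [Category.assoc, Category.assoc, hs, hs, pullback.condition_assoc]
    · rw [Category.assoc, Category.assoc, ht, ht, pullback.condition_assoc]
  let m : T ⟶ R := 𝒰.glueMorphisms r hr
  have hm (x : T) : (O x).ι ≫ m = r x := 𝒰.ι_glueMorphisms _ _ x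
  have hs' (x : T) : (O x).ι ≫ m ≫ s = (O x).ι ≫ a := by rw [reassoc_of% hm, hs]
  have ht' (x : T) : (O x).ι ≫ m ≫ t = (O x).ι ≫ b := by rw [reassoc_of% hm, ht]
  exact ⟨m, 𝒰.hom_ext _ _ hs', 𝒰.hom_ext _ _ ht'⟩

end AlgebraicGeometry

namespace IsEquivRel

open AlgebraicGeometry

variable {R U : Scheme.{u}} {s t : R ⟶ U} (h : IsEquivRel s t)

include h

/-- The quotient by a finite locally free equivalence relation whose classes lie in affine opens.
The relation is the kernel pair of the quotient morphism, which is again finite locally free. -/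
theorem exists_quotient [IsFinite t] [Flat t] [LocallyOfFinitePresentation t]
    (haff : ∀ x : U, ∃ W : U.Opens, IsAffineOpen W ∧ ∀ r, t r = x → s r ∈ W) :
    ∃ (Q : Scheme.{u}) (q : U ⟶ Q), (IsFinite q ∧ Flat q ∧ LocallyOfFinitePresentation q ∧
      Surjective q) ∧ IsPullback s t q q := by
  let c₀ := LocallyRingedSpace.coequalizerCofork s.toLRSHom t.toLRSHom
  have H := IsGeometricQuotient.coequalizerCofork s.toLRSHom t.toLRSHom
  have hchart (x : U) : ∃ W : U.Opens, x ∈ W ∧ s ⁻¹ᵁ W = t ⁻¹ᵁ W ∧ ∃ (A B C : CommRingCat.{u})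
      (i : Spec A ⟶ U) (k : Spec B ⟶ R) (c : Spec A ⟶ Spec C) (f g : Spec B ⟶ Spec A)
      (j : (Spec C).toLocallyRingedSpace ⟶ c₀.pt),
      (IsOpenImmersion i ∧ Set.range i = W) ∧
      (IsFinite c ∧ Flat c ∧ LocallyOfFinitePresentation c ∧ Surjective c) ∧ IsPullback f g c c ∧
      (k ≫ s = f ≫ i ∧ k ≫ t = g ≫ i) ∧
      LocallyRingedSpace.IsOpenImmersion j ∧ c.toLRSHom ≫ j = i.toLRSHom ≫ c₀.π := by
    obtain ⟨W₀, hW₀, hx₀⟩ := haff x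
    obtain ⟨W, hW, hxW, hinv, C, c, ⟨h₁, h₂, h₃, h₄⟩, hpb⟩ := h.exists_isPushout x hW₀ hx₀
    obtain ⟨j, hj, w⟩ := exists_openImmersion_coequalizer hW hinv c hpb
    have hW' := hW.preimage t
    exact ⟨W, hxW, hinv, _, _, C, hW.fromSpec, hW'.fromSpec, Spec.map c, _, _, j,
      ⟨inferInstance, hW.range_fromSpec⟩, ⟨h₁, h₂, h₃, h₄⟩, hpb,
      ⟨(hW.SpecMap_appLE_fromSpec s hW' hinv.ge).symm,
        (hW.SpecMap_appLE_fromSpec t hW' le_rfl).symm⟩, hj, w⟩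
  let Q : Scheme.{u} := LocallyRingedSpace.IsOpenImmersion.scheme c₀.pt fun y => by
    obtain ⟨x, hx⟩ := H.isQuotientMap.surjective y
    obtain ⟨W, hxW, -, A, B, C, i, k, c, f, g, j, hi, -, -, -, hj, w⟩ := hchart x
    refine ⟨C, j, ?_, hj⟩
    obtain ⟨z, rfl⟩ := hi.2.ge hxW
    exact ⟨c z, (congrArg (fun m : _ ⟶ c₀.pt => m.toShHom.hom.base z) w).trans hx⟩
  let q : U ⟶ Q := ⟨c₀.π⟩
  have hq : s ≫ q = t ≫ q := Scheme.Hom.ext' c₀.condition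
  have hqs : Function.Surjective q := H.isQuotientMap.surjective
  have hchart' (x : U) : ∃ W : U.Opens, x ∈ W ∧ ∃ (A B C : CommRingCat.{u})
      (i : Spec A ⟶ U) (k : Spec B ⟶ R) (c : Spec A ⟶ Spec C) (f g : Spec B ⟶ Spec A)
      (j : Spec C ⟶ Q), IsOpenImmersion j ∧ Set.range i = W ∧
      (IsFinite c ∧ Flat c ∧ LocallyOfFinitePresentation c ∧ Surjective c) ∧ IsPullback f g c c ∧
      (k ≫ s = f ≫ i ∧ k ≫ t = g ≫ i) ∧ IsPullback i c q j := by
    obtain ⟨W, hxW, hinv, A, B, C, i, k, c, f, g, j, ⟨_, hiW⟩, hc, hpb, hk, hj, w⟩ := hchart x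
    let j' : Spec C ⟶ Q := ⟨j⟩
    have : IsOpenImmersion j' := hj
    have w' : i ≫ q = c ≫ j' := Scheme.Hom.ext' w.symm
    refine ⟨W, hxW, A, B, C, i, k, c, f, g, j', this, hiW, hc, hpb, hk, ?_⟩
    refine (IsOpenImmersion.isPullback c i j' q w' ?_).flip
    -- the chart is invariant, so it is the full preimage of its image
    have key (x y : U) (hxy : Relation.EqvGen (fun x y : U => ∃ r : R, s r = x ∧ t r = y) x y) :
        x ∈ W ↔ y ∈ W := by
      induction hxy with
      | rel x y hr =>
        obtain ⟨r, rfl, rfl⟩ := hr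
        change r ∈ s ⁻¹ᵁ W ↔ r ∈ t ⁻¹ᵁ W
        rw [hinv]
      | refl => rfl
      | symm _ _ _ ih => exact ih.symm
      | trans _ _ _ _ _ ih₁ ih₂ => exact ih₁.trans ih₂
    ext y
    constructor
    · rintro ⟨z, hz⟩
      obtain ⟨a, rfl⟩ := hc.2.2.2.surj z
      have h1 : q (i a) = q y :=
        (congrArg (fun m : _ ⟶ Q => m a) w').trans hz
      have h2 : i a ∈ W := hiW.le ⟨a, rfl⟩
      exact hiW.ge ((key _ _ (H.eqvGen _ _ h1)).mp h2)
    · rintro ⟨a, rfl⟩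
      exact ⟨c a, (congrArg (fun m : _ ⟶ Q => m a) w').symm⟩
  have hlocal (P : MorphismProperty Scheme.{u}) [IsZariskiLocalAtTarget P]
      (hP : ∀ {A C : CommRingCat.{u}} (c : Spec A ⟶ Spec C), (IsFinite c ∧ Flat c ∧
        LocallyOfFinitePresentation c ∧ Surjective c) → P c) : P q := by
    refine IsZariskiLocalAtTarget.of_forall_exists_morphismRestrict fun y => ?_
    obtain ⟨x, rfl⟩ := hqs y
    obtain ⟨W, hxW, A, B, C, i, k, c, f, g, j, _, hiW, hc, -, -, hpb⟩ := hchart' x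
    refine ⟨j.opensRange, ?_, ?_⟩
    · obtain ⟨a, rfl⟩ := hiW.ge hxW
      exact ⟨c a, (congrArg (fun m : _ ⟶ Q => m a) hpb.w).symm⟩
    · refine (P.arrow_mk_iso_iff (morphismRestrictOpensRange q j)).mpr ?_
      have e : hpb.isoPullback.hom ≫ pullback.snd q j = c := hpb.isoPullback_hom_snd
      rw [← P.cancel_left_of_respectsIso hpb.isoPullback.hom, e]
      exact hP c hc
  have : IsZariskiLocalAtTarget @IsFinite.{u} :=
    @HasAffineProperty.instIsZariskiLocalAtTarget @IsFinite (affineAnd RingHom.Finite)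
      ((HasAffineProperty.affineAnd_iff _ RingHom.finite_respectsIso
        RingHom.finite_localizationPreserves.away RingHom.finite_ofLocalizationSpan).mpr
          fun f => isFinite_iff f)
  have : IsZariskiLocalAtTarget @Flat.{u} :=
    @HasRingHomProperty.instIsZariskiLocalAtTarget @Flat RingHom.Flat inferInstance
  have : IsZariskiLocalAtTarget @LocallyOfFinitePresentation.{u} :=
    @HasRingHomProperty.instIsZariskiLocalAtTarget @LocallyOfFinitePresentation
      RingHom.FinitePresentation inferInstance
  refine ⟨Q, q, ⟨hlocal @IsFinite fun c hc => hc.1, hlocal @Flat fun c hc => hc.2.1,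
    hlocal @LocallyOfFinitePresentation fun c hc => hc.2.2.1, ⟨hqs⟩⟩, ?_⟩
  have kp {T : Scheme.{u}} (a b : T ⟶ U) (hab : a ≫ q = b ≫ q) :
      ∃ r : T ⟶ R, r ≫ s = a ∧ r ≫ t = b := by
    refine exists_lift_of_forall_exists h.injective a b fun x => ?_
    obtain ⟨W, hxW, A, B, C, i, k, c, f, g, j, _, hiW, hc, hfg, hk, hpb⟩ := hchart' (a x)
    let O : T.Opens := (a ≫ q) ⁻¹ᵁ j.opensRange
    have hO (y : O) : ∃ z, j z = (a ≫ q) y := y.2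
    let l : O.toScheme ⟶ Spec C := IsOpenImmersion.lift j (O.ι ≫ a ≫ q) (by
      rintro _ ⟨y, rfl⟩
      exact hO y)
    have hl : l ≫ j = O.ι ≫ a ≫ q := IsOpenImmersion.lift_fac _ _ _
    let a' := hpb.lift (O.ι ≫ a) l (by rw [hl, Category.assoc])
    let b' := hpb.lift (O.ι ≫ b) l (by rw [hl, Category.assoc, hab])
    refine ⟨O, hfg.lift a' b' (by simp [a', b']) ≫ k, ?_, ?_, ?_⟩
    · obtain ⟨z, hz⟩ := hiW.ge hxW
      refine ⟨c z, (congrArg (fun m : _ ⟶ Q => m z) hpb.w).symm.trans ?_⟩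
      exact congrArg q hz
    · rw [Category.assoc, hk.1, hfg.lift_fst_assoc, hpb.lift_fst]
    · rw [Category.assoc, hk.2, hfg.lift_snd_assoc, hpb.lift_fst]
  exact h.isPullback_of_forall_exists hq kp

end IsEquivRel

/-! ### Quotients by equivalence relations with a quasi-section -/

/-- Coequalizers of a relation `p₁, p₂ : R ⇉ X` can be computed on a subobject `U` of `X` that is
reached from a cover of `X`: here `k : V ⟶ R` restricts the relation to `s, t : V ⇉ U`, and
`l : P ⟶ R` consists of equivalences `l ≫ p₁` to `l ≫ p₂` starting in `U`. -/
lemma IsCoequalizerOf.of_restrict {C : Type w} [Category.{v} C] {R X U P V Q : C} {p₁ p₂ : R ⟶ X}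
    {i : U ⟶ X} {s t : V ⟶ U} {k : V ⟶ R} {l : P ⟶ R} {e : P ⟶ U} {q : U ⟶ Q} {π : X ⟶ Q}
    (hq : IsCoequalizerOf s t q) (hs : k ≫ p₁ = s ≫ i) (ht : k ≫ p₂ = t ≫ i)
    (he : l ≫ p₁ = e ≫ i) [Epi (l ≫ p₂)] (hi : i ≫ π = q) (hπ : p₁ ≫ π = p₂ ≫ π) :
    IsCoequalizerOf p₁ p₂ π := by
  obtain ⟨w, ⟨hc⟩⟩ := hq
  have hd (c : Cofork p₁ p₂) : ∃ d : Q ⟶ c.pt, π ≫ d = c.π := by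
    obtain ⟨d, hd⟩ := Cofork.IsColimit.desc' hc (i ≫ c.π) (by
      rw [← reassoc_of% hs, ← reassoc_of% ht, c.condition])
    refine ⟨d, (cancel_epi (l ≫ p₂)).mp ?_⟩
    have hd' : q ≫ d = i ≫ c.π := hd
    rw [Category.assoc, ← reassoc_of% hπ, reassoc_of% he, reassoc_of% hi, hd', ← reassoc_of% he,
      c.condition, Category.assoc]
  choose d hd using hd
  refine ⟨hπ, ⟨Cofork.IsColimit.mk _ d hd fun c m hm => Cofork.IsColimit.hom_ext hc ?_⟩⟩
  change q ≫ m = q ≫ d c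
  rw [← hi, Category.assoc, Category.assoc, hd]
  exact congrArg (i ≫ ·) hm

/-- The restriction of an equivalence relation to a subobject. -/
lemma IsEquivRel.restrict {C : Type w} [Category.{v} C] {R X U V : C} {p₁ p₂ : R ⟶ X}
    (h : IsEquivRel p₁ p₂) {i : U ⟶ X} [Mono i] {s t : V ⟶ U} {k : V ⟶ R} (hs : k ≫ p₁ = s ≫ i)
    (ht : k ≫ p₂ = t ≫ i) (H : ∀ ⦃T : C⦄ (a b : T ⟶ U) (r : T ⟶ R), r ≫ p₁ = a ≫ i →
      r ≫ p₂ = b ≫ i → ∃ m : T ⟶ V, m ≫ s = a ∧ m ≫ t = b)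
    (hinj : ∀ ⦃T : C⦄ (m m' : T ⟶ V), m ≫ k = m' ≫ k → m ≫ t = m' ≫ t → m = m') :
    IsEquivRel s t where
  injective T m m' h₁ h₂ := by
    refine hinj m m' (h.injective _ _ ?_ ?_) h₂
    · rw [Category.assoc, Category.assoc, hs, reassoc_of% h₁]
    · rw [Category.assoc, Category.assoc, ht, reassoc_of% h₂]
  equivalence T := by
    have key : (fun a b : T ⟶ U => ∃ m : T ⟶ V, m ≫ s = a ∧ m ≫ t = b) =
        fun a b => ∃ r : T ⟶ R, r ≫ p₁ = a ≫ i ∧ r ≫ p₂ = b ≫ i := by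
      ext a b
      constructor
      · rintro ⟨m, rfl, rfl⟩
        exact ⟨m ≫ k, by rw [Category.assoc, hs, Category.assoc],
          by rw [Category.assoc, ht, Category.assoc]⟩
      · rintro ⟨r, h₁, h₂⟩
        exact H a b r h₁ h₂
    rw [key]
    exact (h.equivalence T).comap (· ≫ i)

/-- An equivalence relation over `S` is one in the category of all schemes. -/
lemma IsEquivRel.left {C : Type w} [Category.{v} C] {S : C} {R X : Over S} {p₁ p₂ : R ⟶ X}
    (h : IsEquivRel p₁ p₂) : IsEquivRel p₁.left p₂.left where
  injective T r r' h₁ h₂ := by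
    have hr : r' ≫ R.hom = r ≫ R.hom := by
      rw [← Over.w p₁, ← Category.assoc, ← Category.assoc, h₁]
    exact congrArg CommaMorphism.left (h.injective (Over.homMk r rfl : Over.mk (r ≫ R.hom) ⟶ R)
      (Over.homMk r' hr) (by ext1; exact h₁) (by ext1; exact h₂))
  equivalence T := by
    have key {σ : T ⟶ S} (a b : Over.mk σ ⟶ X) (H : ∃ r : Over.mk σ ⟶ R, r ≫ p₁ = a ∧
        r ≫ p₂ = b) : ∃ r : T ⟶ R.left, r ≫ p₁.left = a.left ∧ r ≫ p₂.left = b.left := by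
      obtain ⟨r, rfl, rfl⟩ := H
      exact ⟨r.left, rfl, rfl⟩
    have hw (r : T ⟶ R.left) : (r ≫ p₂.left) ≫ X.hom = (r ≫ p₁.left) ≫ X.hom := by
      rw [Category.assoc, Category.assoc, Over.w, Over.w]
    refine ⟨fun a => ?_, ?_, ?_⟩
    · let a' : Over.mk (a ≫ X.hom) ⟶ X := Over.homMk a rfl
      exact key a' a' ((h.equivalence _).refl a')
    · rintro _ _ ⟨r, rfl, rfl⟩
      let r' : Over.mk (r ≫ R.hom) ⟶ R := Over.homMk r rfl
      exact key (r' ≫ p₂) (r' ≫ p₁) ((h.equivalence _).symm ⟨r', rfl, rfl⟩)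
    · rintro _ _ _ ⟨r, rfl, rfl⟩ ⟨r', hr, rfl⟩
      let a : Over.mk (r ≫ R.hom) ⟶ R := Over.homMk r rfl
      let b : Over.mk (r ≫ R.hom) ⟶ R := Over.homMk r' (by
        rw [← Over.w p₁, reassoc_of% hr]
        exact congrArg (r ≫ ·) ((Over.w p₂).trans (Over.w p₁).symm))
      exact key (a ≫ p₁) (b ≫ p₂) ((h.equivalence _).trans ⟨a, rfl, rfl⟩
        ⟨b, by ext1; exact hr, rfl⟩)

namespace AlgebraicGeometry

lemma IsFiniteLocallyFree.flat_and_locallyOfFinitePresentation {X Y : Scheme.{u}} {f : X ⟶ Y}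
    (hf : IsFiniteLocallyFree f) : Flat f ∧ LocallyOfFinitePresentation f := by
  obtain ⟨_, hf⟩ := hf
  have key (P : MorphismProperty Scheme.{u}) [IsZariskiLocalAtTarget P] (hP : ∀ {W : Y.Opens},
      IsAffineOpen W → (letI := (f.app W).hom.toAlgebra; Module.Free Γ(Y, W) Γ(X, f ⁻¹ᵁ W)) →
        P (Spec.map (f.app W))) : P f := by
    refine IsZariskiLocalAtTarget.of_forall_exists_morphismRestrict fun y => ?_
    obtain ⟨W, hyW, hW, hfree⟩ := hf y
    have hW' := hW.preimage f
    have hpb : IsPullback (Spec.map (f.app W)) hW'.fromSpec hW.fromSpec f := by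
      refine IsOpenImmersion.isPullback _ _ _ _ ?_ ?_
      · rw [← f.appLE_eq_app, hW.SpecMap_appLE_fromSpec f hW' le_rfl]
      · rw [hW.opensRange_fromSpec, hW'.opensRange_fromSpec]
    refine ⟨hW.fromSpec.opensRange, by rwa [hW.opensRange_fromSpec], ?_⟩
    refine (P.arrow_mk_iso_iff (morphismRestrictOpensRange f _)).mpr ?_
    have e : hpb.flip.isoPullback.hom ≫ pullback.snd f hW.fromSpec = Spec.map (f.app W) :=
      hpb.flip.isoPullback_hom_snd
    rw [← P.cancel_left_of_respectsIso hpb.flip.isoPullback.hom, e]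
    exact hP hW hfree
  have : IsZariskiLocalAtTarget @Flat.{u} :=
    @HasRingHomProperty.instIsZariskiLocalAtTarget @Flat RingHom.Flat inferInstance
  have : IsZariskiLocalAtTarget @LocallyOfFinitePresentation.{u} :=
    @HasRingHomProperty.instIsZariskiLocalAtTarget @LocallyOfFinitePresentation
      RingHom.FinitePresentation inferInstance
  refine ⟨key @Flat fun {W} hW hfree => ?_, key @LocallyOfFinitePresentation fun {W} hW hfree => ?_⟩
  · rw [Flat.SpecMap_iff]
    let := (f.app W).hom.toAlgebra
    exact RingHom.flat_algebraMap_iff.mpr inferInstance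
  · rw [LocallyOfFinitePresentation.SpecMap_iff]
    let := (f.app W).hom.toAlgebra
    have : Module.Finite Γ(Y, W) Γ(X, f ⁻¹ᵁ W) := f.finite_app W hW
    have : Module.FinitePresentation Γ(Y, W) Γ(X, f ⁻¹ᵁ W) :=
      Module.finitePresentation_of_projective _ _
    exact RingHom.finitePresentation_algebraMap.mpr inferInstance

end AlgebraicGeometry

namespace IsEquivRel

variable {R X U : Scheme.{u}} {p₁ p₂ : R ⟶ X} {i : U ⟶ X}

/-- The restriction of an equivalence relation to a subscheme, realized on the scheme
`p₁⁻¹(U) ∩ p₂⁻¹(U)`. -/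
lemma restrict_pullback (h : IsEquivRel p₁ p₂) [Mono i] :
    IsEquivRel (pullback.fst (pullback.fst p₁ i ≫ p₂) i ≫ pullback.snd p₁ i)
      (pullback.snd (pullback.fst p₁ i ≫ p₂) i) := by
  refine h.restrict (i := i) (k := pullback.fst (pullback.fst p₁ i ≫ p₂) i ≫ pullback.fst p₁ i)
    ?_ ?_ ?_ ?_
  · simp only [Category.assoc, pullback.condition]
  · rw [Category.assoc, pullback.condition]
  · intro T a b r h₁ h₂
    exact ⟨pullback.lift (pullback.lift r a h₁) b (by rw [pullback.lift_fst_assoc, h₂]),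
      by rw [pullback.lift_fst_assoc, pullback.lift_snd], by rw [pullback.lift_snd]⟩
  · intro T m m' h₁ h₂
    refine pullback.hom_ext (pullback.hom_ext ?_ ?_) h₂
    · simpa only [Category.assoc] using h₁
    · rw [← cancel_mono i]
      simpa only [Category.assoc, pullback.condition] using congrArg (· ≫ p₁) h₁

variable (h : IsEquivRel p₁ p₂) (hi : IsQuasiSection p₁ p₂ i)

include h hi

/-- The quotient `q : U ⟶ Q` of a quasi-section extends to `X` by descent along the cover
`p₂ : p₁⁻¹(U) ⟶ X`. -/
theorem exists_quotient_of_isQuasiSection : ∃ (Q : Scheme.{u}) (q : U ⟶ Q) (π : X ⟶ Q),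
    (IsFinite q ∧ Flat q ∧ LocallyOfFinitePresentation q ∧ Surjective q) ∧
    IsPullback (pullback.fst (pullback.fst p₁ i ≫ p₂) i ≫ pullback.snd p₁ i)
      (pullback.snd (pullback.fst p₁ i ≫ p₂) i) q q ∧ i ≫ π = q ∧ p₁ ≫ π = p₂ ≫ π := by
  have := hi.isImmersion
  have : IsFinite (pullback.fst p₁ i ≫ p₂) := hi.isFiniteLocallyFree.1
  obtain ⟨_, _⟩ := hi.isFiniteLocallyFree.flat_and_locallyOfFinitePresentation
  have := hi.surjective
  obtain ⟨Q, q, hq, hpb⟩ := h.restrict_pullback (i := i).exists_quotient fun x => by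
    obtain ⟨W, hW, hxW⟩ := hi.exists_isAffineOpen x
    refine ⟨W, hW, fun r hr => hxW _ ?_⟩
    refine ⟨(pullback.fst (pullback.fst p₁ i ≫ p₂) i ≫ pullback.fst p₁ i) r, ?_, ?_⟩
    · change p₂ _ = _
      rw [← hr]
      exact congrArg (fun f : pullback (pullback.fst p₁ i ≫ p₂) i ⟶ X => f r)
        ((Category.assoc _ _ _).trans pullback.condition)
    · have : (pullback.fst (pullback.fst p₁ i ≫ p₂) i ≫ pullback.fst p₁ i) ≫ p₁ =
          (pullback.fst (pullback.fst p₁ i ≫ p₂) i ≫ pullback.snd p₁ i) ≫ i := by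
        simp only [Category.assoc, pullback.condition]
      exact congrArg (fun f : pullback (pullback.fst p₁ i ≫ p₂) i ⟶ X => f r) this
  -- points of `U` that are equivalent in `X` have the same image under `q`
  have hqR {T : Scheme.{u}} (a b : T ⟶ U) (r : T ⟶ R) (h₁ : r ≫ p₁ = a ≫ i)
      (h₂ : r ≫ p₂ = b ≫ i) : a ≫ q = b ≫ q := by
    let m : T ⟶ pullback (pullback.fst p₁ i ≫ p₂) i :=
      pullback.lift (pullback.lift r a h₁) b (by rw [pullback.lift_fst_assoc, h₂])
    have hm₁ : m ≫ pullback.fst _ _ ≫ pullback.snd _ _ = a := by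
      rw [pullback.lift_fst_assoc, pullback.lift_snd]
    have hm₂ : m ≫ pullback.snd _ _ = b := pullback.lift_snd _ _ _
    rw [← hm₁, ← hm₂, Category.assoc, hpb.w, Category.assoc]
  have hf {T : Scheme.{u}} (r r' : T ⟶ pullback p₁ i)
      (w : r ≫ pullback.fst p₁ i ≫ p₂ = r' ≫ pullback.fst p₁ i ≫ p₂) :
      r ≫ pullback.snd p₁ i ≫ q = r' ≫ pullback.snd p₁ i ≫ q := by
    obtain ⟨m, hm₁, hm₂⟩ := h.exists_symm (r' ≫ pullback.fst p₁ i)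
    obtain ⟨m', hm'₁, hm'₂⟩ := h.exists_trans (r ≫ pullback.fst p₁ i) m (by
      rw [Category.assoc, w, hm₁, Category.assoc])
    rw [← Category.assoc, ← Category.assoc]
    refine hqR _ _ m' ?_ ?_
    · rw [hm'₁, Category.assoc, Category.assoc, pullback.condition]
    · rw [hm'₂, hm₂, Category.assoc, Category.assoc, pullback.condition]
  let π : X ⟶ Q := EffectiveEpi.desc (pullback.fst p₁ i ≫ p₂) (pullback.snd p₁ i ≫ q)
    fun r r' w => hf r r' w
  have hπ : (pullback.fst p₁ i ≫ p₂) ≫ π = pullback.snd p₁ i ≫ q := EffectiveEpi.fac _ _ _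
  refine ⟨Q, q, π, hq, hpb, ?_, ?_⟩
  · rw [← cancel_epi (pullback.snd (pullback.fst p₁ i ≫ p₂) i), ← reassoc_of% pullback.condition,
      hπ, ← hpb.w, Category.assoc]
  · rw [← cancel_epi (pullback.fst p₁ (pullback.fst p₁ i ≫ p₂))]
    let z := pullback.fst p₁ (pullback.fst p₁ i ≫ p₂)
    let z' := pullback.snd p₁ (pullback.fst p₁ i ≫ p₂)
    obtain ⟨m, hm₁, hm₂⟩ := h.exists_trans (z' ≫ pullback.fst p₁ i) z
      ((Category.assoc _ _ _).trans pullback.condition.symm)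
    have hm : m = pullback.lift m (z' ≫ pullback.snd p₁ i) (by
        rw [hm₁, Category.assoc, Category.assoc, pullback.condition]) ≫ pullback.fst p₁ i := by
      rw [pullback.lift_fst]
    rw [reassoc_of% pullback.condition, hπ]
    change _ = z ≫ p₂ ≫ π
    rw [← reassoc_of% hm₂, hm, Category.assoc, ← Category.assoc (pullback.fst p₁ i), hπ,
      pullback.lift_snd_assoc, Category.assoc]

end IsEquivRel

namespace IsEquivRel

/-- Equivalence of two `T`-valued points can be checked after a cover of `T`. -/
lemma exists_lift_of_effectiveEpi {C : Type w} [Category.{v} C] {R X T T' : C} {p₁ p₂ : R ⟶ X}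
    (h : IsEquivRel p₁ p₂) (c : T' ⟶ T) [EffectiveEpi c] {a b : T ⟶ X} (r : T' ⟶ R)
    (h₁ : r ≫ p₁ = c ≫ a) (h₂ : r ≫ p₂ = c ≫ b) : ∃ m : T ⟶ R, m ≫ p₁ = a ∧ m ≫ p₂ = b := by
  let m : T ⟶ R := EffectiveEpi.desc c r fun g g' w => h.injective _ _
    (by rw [Category.assoc, Category.assoc, h₁, reassoc_of% w])
    (by rw [Category.assoc, Category.assoc, h₂, reassoc_of% w])
  have hm : c ≫ m = r := EffectiveEpi.fac _ _ _
  exact ⟨m, by rw [← cancel_epi c, reassoc_of% hm, h₁], by rw [← cancel_epi c, reassoc_of% hm, h₂]⟩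

variable {R X U Q : Scheme.{u}} {p₁ p₂ : R ⟶ X} {i : U ⟶ X}

/-- If `X` is covered by points equivalent to points of `U`, and the quotient of `U` is effective,
so is the quotient of `X`: two points of `X` with the same image in `Q` are replaced, locally for
the flat topology, by equivalent points of `U`. -/
theorem isPullback_of_isQuasiSection (h : IsEquivRel p₁ p₂) (hi : IsQuasiSection p₁ p₂ i)
    {q : U ⟶ Q} {π : X ⟶ Q}
    (hpb : IsPullback (pullback.fst (pullback.fst p₁ i ≫ p₂) i ≫ pullback.snd p₁ i)
      (pullback.snd (pullback.fst p₁ i ≫ p₂) i) q q)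
    (hq : i ≫ π = q) (hπ : p₁ ≫ π = p₂ ≫ π) : IsPullback p₁ p₂ π π := by
  have : IsFinite (pullback.fst p₁ i ≫ p₂) := hi.isFiniteLocallyFree.1
  obtain ⟨_, _⟩ := hi.isFiniteLocallyFree.flat_and_locallyOfFinitePresentation
  have := hi.surjective
  refine h.isPullback_of_forall_exists hπ fun {T} a b hab => ?_
  have key {T : Scheme.{u}} {a b : T ⟶ X} (u v : T ⟶ pullback p₁ i)
      (hu : u ≫ pullback.fst p₁ i ≫ p₂ = a) (hv : v ≫ pullback.fst p₁ i ≫ p₂ = b)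
      (hab : a ≫ π = b ≫ π) : ∃ m : T ⟶ R, m ≫ p₁ = a ∧ m ≫ p₂ = b := by
    have hw (u : T ⟶ pullback p₁ i) : (u ≫ pullback.snd p₁ i) ≫ q =
        (u ≫ pullback.fst p₁ i ≫ p₂) ≫ π := by
      rw [← hq, Category.assoc, ← pullback.condition_assoc, hπ, Category.assoc, Category.assoc]
    obtain ⟨n, hn₁, hn₂⟩ : ∃ n : T ⟶ pullback (pullback.fst p₁ i ≫ p₂) i,
        n ≫ pullback.fst _ _ ≫ pullback.snd _ _ = u ≫ pullback.snd p₁ i ∧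
        n ≫ pullback.snd _ _ = v ≫ pullback.snd p₁ i :=
      hpb.exists_lift _ _ (by rw [hw, hw, hu, hv, hab])
    obtain ⟨m, hm₁, hm₂⟩ := h.exists_symm (u ≫ pullback.fst p₁ i)
    obtain ⟨m', hm'₁, hm'₂⟩ := h.exists_trans m (n ≫ pullback.fst _ _ ≫ pullback.fst p₁ i) (by
      rw [hm₂, Category.assoc, Category.assoc, Category.assoc, pullback.condition,
        reassoc_of% hn₁])
    obtain ⟨m'', hm''₁, hm''₂⟩ := h.exists_trans m' (v ≫ pullback.fst p₁ i) (by
      rw [hm'₂, Category.assoc, Category.assoc, Category.assoc, pullback.condition,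
        pullback.condition, reassoc_of% hn₂])
    refine ⟨m'', ?_, ?_⟩
    · rw [hm''₁, hm'₁, hm₁, ← hu, Category.assoc]
    · rw [hm''₂, ← hv, Category.assoc]
  let f := pullback.fst p₁ i ≫ p₂
  let c := pullback.fst a f
  let c' := pullback.fst (c ≫ b) f
  obtain ⟨m, hm₁, hm₂⟩ := key (a := c' ≫ c ≫ a) (b := c' ≫ c ≫ b) (c' ≫ pullback.snd a f)
    (pullback.snd (c ≫ b) f) (by
      change (c' ≫ pullback.snd a f) ≫ f = c' ≫ pullback.fst a f ≫ a
      rw [Category.assoc, pullback.condition]) pullback.condition.symm (by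
      simp only [Category.assoc, hab])
  obtain ⟨m', hm'₁, hm'₂⟩ := h.exists_lift_of_effectiveEpi c' m hm₁ hm₂
  exact h.exists_lift_of_effectiveEpi c m' hm'₁ hm'₂

end IsEquivRel

/-- An effective epimorphism is the coequalizer of every pair that contains its kernel pair. -/
lemma IsCoequalizerOf.of_effectiveEpi {C : Type w} [Category.{v} C] {V U Q : C} {s t : V ⟶ U}
    {q : U ⟶ Q} [EffectiveEpi q] (hq : s ≫ q = t ≫ q)
    (kp : ∀ {T : C} (a b : T ⟶ U), a ≫ q = b ≫ q → ∃ r : T ⟶ V, r ≫ s = a ∧ r ≫ t = b) :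
    IsCoequalizerOf s t q := by
  have hc (c : Cofork s t) {T : C} (a b : T ⟶ U) (hab : a ≫ q = b ≫ q) : a ≫ c.π = b ≫ c.π := by
    obtain ⟨r, rfl, rfl⟩ := kp a b hab
    rw [Category.assoc, c.condition, Category.assoc]
  exact ⟨hq, ⟨Cofork.IsColimit.mk _ (fun c => EffectiveEpi.desc q c.π fun a b => hc c a b)
    (fun c => EffectiveEpi.fac q _ _) fun c m hm => EffectiveEpi.uniq q _ _ m hm⟩⟩

lemma IsCoequalizerOf.epi {C : Type w} [Category.{v} C] {R X Q : C} {p₁ p₂ : R ⟶ X} {π : X ⟶ Q}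
    (h : IsCoequalizerOf p₁ p₂ π) : Epi π :=
  epi_of_isColimit_cofork h.2.some

/-- A coequalizer in a category is a coequalizer in its slices. -/
lemma IsCoequalizerOf.of_left {C : Type w} [Category.{v} C] {S : C} {R X Q : Over S}
    {p₁ p₂ : R ⟶ X} {π : X ⟶ Q} (h : IsCoequalizerOf p₁.left p₂.left π.left) :
    IsCoequalizerOf p₁ p₂ π := by
  have := h.epi
  obtain ⟨w, ⟨hc⟩⟩ := h
  have hd (c : Cofork p₁ p₂) : ∃ d : Q ⟶ c.pt, π ≫ d = c.π := by
    obtain ⟨d, hd⟩ := Cofork.IsColimit.desc' hc c.π.left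
      (congrArg CommaMorphism.left c.condition)
    have hd : π.left ≫ d = c.π.left := hd
    refine ⟨Over.homMk d ?_, by ext1; exact hd⟩
    rw [← cancel_epi π.left, reassoc_of% hd, Over.w π]
    exact Over.w c.π
  choose d hd using hd
  refine ⟨by ext1; exact w, ⟨Cofork.IsColimit.mk _ d hd fun c m hm => ?_⟩⟩
  ext1
  rw [← cancel_epi π.left]
  exact congrArg CommaMorphism.left (hm.trans (hd c).symm)

namespace AlgebraicGeometry

/-- A faithfully flat quasi-compact morphism is the quotient by its kernel pair in the category of
ringed spaces. -/
theorem isCoequalizerOf_schemeToRingedSpace_of_flat {R Y Z : Scheme.{u}} (q : Y ⟶ Z) [Flat q]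
    [QuasiCompact q] [Surjective q] (f g : R ⟶ Y) (w : f ≫ q = g ≫ q)
    (kp : ∀ {T : Scheme.{u}} (a b : T ⟶ Y), a ≫ q = b ≫ q → ∃ r : T ⟶ R, r ≫ f = a ∧ r ≫ g = b) :
    IsCoequalizerOf (schemeToRingedSpace.map f) (schemeToRingedSpace.map g)
      (schemeToRingedSpace.map q) :=
  IsCoequalizerOf.map LocallyRingedSpace.forgetToSheafedSpace
    (isGeometricQuotient_of_flat q f g w kp).isCoequalizerOf

end AlgebraicGeometry

namespace IsEquivRel

variable {R X U Q : Scheme.{u}} {p₁ p₂ : R ⟶ X} {i : U ⟶ X}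

/-- The quotient `q` of the quasi-section is a coequalizer in schemes and in ringed spaces, and in
both categories the cover of `X` by `p₁⁻¹(U)` is an epimorphism, so `π` is a coequalizer too. -/
theorem isCoequalizerOf_of_isQuasiSection (hi : IsQuasiSection p₁ p₂ i)
    {q : U ⟶ Q} {π : X ⟶ Q} [IsFinite q] [Flat q] [Surjective q]
    (hpb : IsPullback (pullback.fst (pullback.fst p₁ i ≫ p₂) i ≫ pullback.snd p₁ i)
      (pullback.snd (pullback.fst p₁ i ≫ p₂) i) q q)
    (hq : i ≫ π = q) (hπ : p₁ ≫ π = p₂ ≫ π) :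
    IsCoequalizerOf p₁ p₂ π ∧ IsCoequalizerOf (schemeToRingedSpace.map p₁)
      (schemeToRingedSpace.map p₂) (schemeToRingedSpace.map π) := by
  have : IsFinite (pullback.fst p₁ i ≫ p₂) := hi.isFiniteLocallyFree.1
  obtain ⟨_, _⟩ := hi.isFiniteLocallyFree.flat_and_locallyOfFinitePresentation
  have := hi.surjective
  have kp {T : Scheme.{u}} (a b : T ⟶ U) (hab : a ≫ q = b ≫ q) := hpb.exists_lift a b hab
  have hs : (pullback.fst (pullback.fst p₁ i ≫ p₂) i ≫ pullback.fst p₁ i) ≫ p₁ =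
      (pullback.fst (pullback.fst p₁ i ≫ p₂) i ≫ pullback.snd p₁ i) ≫ i := by
    simp only [Category.assoc, pullback.condition]
  have ht : (pullback.fst (pullback.fst p₁ i ≫ p₂) i ≫ pullback.fst p₁ i) ≫ p₂ =
      pullback.snd (pullback.fst p₁ i ≫ p₂) i ≫ i := by
    rw [Category.assoc, pullback.condition]
  refine ⟨.of_restrict (.of_effectiveEpi hpb.w kp) hs ht pullback.condition hq hπ, ?_⟩
  have hepi : Epi (schemeToRingedSpace.map (pullback.fst p₁ i) ≫ schemeToRingedSpace.map p₂) := by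
    rw [← Functor.map_comp]
    exact (isCoequalizerOf_schemeToRingedSpace_of_flat (pullback.fst p₁ i ≫ p₂) _ _
      pullback.condition fun a b hab => 
        ⟨pullback.lift a b hab, pullback.lift_fst _ _ _, pullback.lift_snd _ _ _⟩).epi
  refine .of_restrict (i := schemeToRingedSpace.map i)
    (isCoequalizerOf_schemeToRingedSpace_of_flat q _ _ hpb.w kp)
    (k := schemeToRingedSpace.map (pullback.fst (pullback.fst p₁ i ≫ p₂) i ≫ pullback.fst p₁ i))
    (l := schemeToRingedSpace.map (pullback.fst p₁ i))
    (e := schemeToRingedSpace.map (pullback.snd p₁ i)) ?_ ?_ ?_ ?_ ?_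
  · rw [← Functor.map_comp, hs, Functor.map_comp]
  · rw [← Functor.map_comp, ht, Functor.map_comp]
  · rw [← Functor.map_comp, pullback.condition, Functor.map_comp]
  · rw [← Functor.map_comp, hq]
  · rw [← Functor.map_comp, hπ, Functor.map_comp]

end IsEquivRel

/-! ### Properties of the quotient morphism -/

namespace AlgebraicGeometry

lemma Flat.descendsAlong_flat :
    MorphismProperty.DescendsAlong @Flat.{u} (@Surjective ⊓ @Flat ⊓ @QuasiCompact) := by
  refine HasRingHomProperty.descendsAlong_flat (Q := RingHom.Flat) ?_
  refine .mk _ RingHom.Flat.respectsIso fun A B C _ _ _ _ _ h₁ h₂ => ?_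
  rw [RingHom.faithfullyFlat_algebraMap_iff] at h₁
  rw [RingHom.flat_algebraMap_iff] at h₂ ⊢
  exact Module.Flat.of_flat_tensorProduct A C B

/-- The base change of an open morphism along an immersion is open. -/
lemma isOpenMap_pullback_snd {R X U : Scheme.{u}} {p : R ⟶ X} (hp : IsOpenMap p) (i : U ⟶ X)
    [IsImmersion i] : IsOpenMap (pullback.snd p i) := by
  intro O hO
  obtain ⟨O', hO', rfl⟩ := (pullback.fst p i).isEmbedding.isInducing.isOpen_iff.mp hO
  convert (hp O' hO').preimage i.continuous
  ext y
  constructor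
  · rintro ⟨z, hz, rfl⟩
    exact ⟨_, hz, congrArg (fun f : pullback p i ⟶ X => f z) pullback.condition⟩
  · rintro ⟨r, hr, hry⟩
    obtain ⟨z, rfl, rfl⟩ := Scheme.Pullback.exists_preimage_pullback (f := p) (g := i) r y hry
    exact ⟨z, hr, rfl⟩

lemma QuasiCompact.of_comp_surjective {X Y Z : Scheme.{u}} (f : X ⟶ Y) (g : Y ⟶ Z) [Surjective f]
    [QuasiCompact (f ≫ g)] : QuasiCompact g where
  isCompact_preimage O hO hO' := by
    have h := (QuasiCompact.isCompact_preimage (f := f ≫ g) O hO hO').image f.continuous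
    change IsCompact (f '' (f ⁻¹' (g ⁻¹' O))) at h
    rwa [Set.image_preimage_eq _ f.surjective] at h

/-- The Artin–Tate lemma for schemes. Flatness is only used to make functions on `Q` inject into
functions on `U`. -/
lemma LocallyOfFiniteType.of_comp_isFinite {U Q S : Scheme.{u}} (q : U ⟶ Q) (σ : Q ⟶ S)
    [IsLocallyNoetherian S] [IsFinite q] [Flat q] [Surjective q] [LocallyOfFiniteType (q ≫ σ)] :
    LocallyOfFiniteType σ where
  finiteType_appLE {V} hV {W} hW e := by
    have hW' : IsAffineOpen (q ⁻¹ᵁ W) := hW.preimage q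
    have := IsLocallyNoetherian.component_noetherian ⟨V, hV⟩
    have e' : q ⁻¹ᵁ W ≤ (q ≫ σ) ⁻¹ᵁ V := by
      rw [Scheme.Hom.comp_preimage]; exact q.preimage_mono e
    have h1 := (q ≫ σ).finiteType_appLE hV hW' e'
    let := (σ.appLE V W e).hom.toAlgebra
    let := (q.app W).hom.toAlgebra
    let := ((q ≫ σ).appLE V (q ⁻¹ᵁ W) e').hom.toAlgebra
    have hcomp : (q ≫ σ).appLE V (q ⁻¹ᵁ W) e' = σ.appLE V W e ≫ q.app W := by
      rw [← q.appLE_eq_app, Scheme.Hom.appLE_comp_appLE]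
    have : IsScalarTower Γ(S, V) Γ(Q, W) Γ(U, q ⁻¹ᵁ W) := .of_algebraMap_eq fun x =>
      congrArg (fun f : Γ(S, V) ⟶ Γ(U, q ⁻¹ᵁ W) => f x) hcomp
    have h2 : Module.Finite Γ(Q, W) Γ(U, q ⁻¹ᵁ W) := q.finite_app W hW
    have h3 : Algebra.FiniteType Γ(S, V) Γ(U, q ⁻¹ᵁ W) := h1
    exact ⟨fg_of_fg_of_fg Γ(S, V) Γ(Q, W) Γ(U, q ⁻¹ᵁ W) h3.1 h2.1 (q.injective_app_of_flat W)⟩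

/-- A locally noetherian scheme is quasi-separated over every scheme, so over it finite
presentation only needs quasi-compactness. -/
lemma isOfFinitePresentation_of_isLocallyNoetherian {X Y : Scheme.{u}} (f : X ⟶ Y)
    [IsLocallyNoetherian X] (hf : LocallyOfFinitePresentation f) [QuasiCompact f] :
    IsOfFinitePresentation f :=
  ⟨hf, inferInstance, inferInstance⟩

end AlgebraicGeometry

namespace IsEquivRel

variable {R X U Q : Scheme.{u}} {p₁ p₂ : R ⟶ X} {i : U ⟶ X}

/-- The quotient morphism `π : X ⟶ Q` inherits properties of `p₁`: both `p₁⁻¹(U) ⟶ U ⟶ Q` and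
`p₁⁻¹(U) ⟶ X ⟶ Q` are the same morphism, and `p₁⁻¹(U) ⟶ X` is surjective. -/
theorem inherits_of_isQuasiSection (hi : IsQuasiSection p₁ p₂ i)
    {q : U ⟶ Q} {π : X ⟶ Q} [IsFinite q] [Flat q] [LocallyOfFinitePresentation q] [Surjective q]
    (hq : i ≫ π = q) (hπ : IsPullback p₁ p₂ π π) : (IsOpenMap p₁ → IsOpenMap π) ∧
      (UniversallyClosed p₁ → UniversallyClosed π) ∧ (Flat p₁ → Flat π) := by
  have := hi.isImmersion
  have := hi.surjective
  have hpb : IsPullback (pullback.snd p₁ i) (pullback.fst p₁ i ≫ p₂) q π :=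
    hq ▸ ((IsPullback.of_hasPullback p₁ i).paste_horiz hπ.flip).flip
  refine ⟨fun h O hO => ?_, fun h => ?_, fun h => ?_⟩
  · have hO' : (π : X → Q) '' O =
        q '' (pullback.snd p₁ i '' ((pullback.fst p₁ i ≫ p₂) ⁻¹' O)) := by
      have hw (z : ↥(pullback p₁ i)) : q (pullback.snd p₁ i z) = π ((pullback.fst p₁ i ≫ p₂) z) :=
        congrArg (fun f : pullback p₁ i ⟶ Q => f z) hpb.w
      ext y
      constructor
      · rintro ⟨x, hx, rfl⟩
        obtain ⟨z, rfl⟩ := (pullback.fst p₁ i ≫ p₂).surjective x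
        exact ⟨_, ⟨z, hx, rfl⟩, hw z⟩
      · rintro ⟨_, ⟨z, hz, rfl⟩, rfl⟩
        exact ⟨_, hz, (hw z).symm⟩
    rw [hO']
    exact q.isOpenMap _ (isOpenMap_pullback_snd h i _
      (hO.preimage (pullback.fst p₁ i ≫ p₂).continuous))
  · have : UniversallyClosed ((pullback.fst p₁ i ≫ p₂) ≫ π) := by
      rw [← hpb.w]; infer_instance
    exact .of_comp_surjective (pullback.fst p₁ i ≫ p₂) π
  · exact Flat.descendsAlong_flat.of_isPullback hpb ⟨⟨‹_›, ‹_›⟩, inferInstance⟩ inferInstance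

end IsEquivRel

theorem mainTheorem4 {S : Scheme.{u}} {R X : Over S} (p₁ p₂ : R ⟶ X) (hR : IsEquivRel p₁ p₂)
    (hU : ∃ (U : Scheme.{u}) (i : U ⟶ X.left), IsQuasiSection p₁.left p₂.left i) :
    ∃ (Q : Over S) (π : X ⟶ Q),
      -- `π` is a cokernel in schemes over `S` and in ringed spaces
      IsCoequalizerOf p₁ p₂ π ∧
      IsCoequalizerOf (schemeToRingedSpace.map p₁.left) (schemeToRingedSpace.map p₂.left)
        (schemeToRingedSpace.map π.left) ∧
      -- surjectivity, and properties inherited from `p₁`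
      Surjective π.left ∧
      (IsOpenMap p₁.left → IsOpenMap π.left) ∧
      (UniversallyClosed p₁.left → UniversallyClosed π.left) ∧
      (Flat p₁.left → Flat π.left) ∧
      -- finiteness over a locally noetherian base
      (IsLocallyNoetherian S → LocallyOfFiniteType X.hom →
        LocallyOfFinitePresentation π.left ∧ LocallyOfFinitePresentation Q.hom) ∧
      (IsLocallyNoetherian S → LocallyOfFiniteType X.hom → QuasiCompact X.hom →
        IsOfFinitePresentation π.left ∧ IsOfFinitePresentation Q.hom) ∧
      -- the canonical morphism from `R` to the fibre product of `X` with itself over `Q`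
      ∃ h : p₁.left ≫ π.left = p₂.left ≫ π.left,
        IsIso (pullback.lift p₁.left p₂.left h : R.left ⟶ pullback π.left π.left) := by
  obtain ⟨U, i, hi⟩ := hU
  obtain ⟨Q, q, π, ⟨_, _, _, _⟩, hpb, hq, hπ⟩ := hR.left.exists_quotient_of_isQuasiSection hi
  have hπ' := hR.left.isPullback_of_isQuasiSection hi hpb hq hπ
  obtain ⟨hcoeq, hcoeq'⟩ := IsEquivRel.isCoequalizerOf_of_isQuasiSection hi hpb hq hπ
  obtain ⟨hopen, hclosed, hflat⟩ := IsEquivRel.inherits_of_isQuasiSection hi hq hπ'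
  have := hi.isImmersion
  have hsurj : Surjective π := by
    have : Surjective (i ≫ π) := by rwa [hq]
    exact .of_comp i π
  -- the structure morphism of `X` is constant on equivalence classes
  obtain ⟨σ, hσ⟩ : ∃ σ : Q ⟶ S, π ≫ σ = X.hom :=
    ⟨Cofork.IsColimit.desc hcoeq.2.some X.hom ((Over.w p₁).trans (Over.w p₂).symm),
      Cofork.IsColimit.π_desc' hcoeq.2.some X.hom _⟩
  have hfin (_ : IsLocallyNoetherian S) (_ : LocallyOfFiniteType X.hom) :
      LocallyOfFinitePresentation π ∧ LocallyOfFinitePresentation σ := by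
    have : LocallyOfFiniteType (q ≫ σ) := by
      rw [← hq, Category.assoc, hσ]; infer_instance
    have : LocallyOfFiniteType σ := .of_comp_isFinite q σ
    have : IsLocallyNoetherian Q := LocallyOfFiniteType.isLocallyNoetherian σ
    have : LocallyOfFiniteType (π ≫ σ) := by rwa [hσ]
    have : LocallyOfFiniteType π := locallyOfFiniteType_of_comp π σ
    exact ⟨inferInstance, inferInstance⟩
  refine ⟨Over.mk σ, Over.homMk π hσ, hcoeq.of_left, hcoeq', hsurj, hopen, hclosed, hflat, hfin,
    fun hS hX _ => ?_, hπ, ?_⟩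
  · obtain ⟨hπf, hσf⟩ := hfin hS hX
    have : IsLocallyNoetherian X.left := LocallyOfFiniteType.isLocallyNoetherian X.hom
    have : IsLocallyNoetherian Q := LocallyOfFiniteType.isLocallyNoetherian σ
    have : QuasiCompact (π ≫ σ) := by rwa [hσ]
    have : QuasiCompact π := .of_comp π σ
    have : QuasiCompact σ := .of_comp_surjective π σ
    exact ⟨isOfFinitePresentation_of_isLocallyNoetherian π hπf,
      isOfFinitePresentation_of_isLocallyNoetherian σ hσf⟩
  · exact (IsPullback.isoPullback hπ').isIso_hom
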